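/- Let $(\Omega,\mathcal F,\mathbb P)$ be a probability space. A diffusion on $\mathbb R^d$ is a family $(X^x)_{x\in\mathbb R^d}$ of time-homogeneous Markov processes with almost surely continuous paths, $X^x_0=x$ a.s., and with common transition kernels. Its semigroup is $P^X_t\varphi(x)=\mathbb E\,\varphi(X^x_t)$ for $\varphi$ bounded and measurable. Its generator $\mathcal L_X$ is $\mathcal L_X\varphi=\lim_{t\downarrow0}(P^X_t\varphi-\varphi)/t$, where $D(\mathcal L_X)$ is the set of bounded measurable $\varphi$ for which the limit exists uniformly. Put $D(\mathcal L_X^0)=\{\varphi \text{ bounded measurable}:\|P^X_t\varphi-\varphi\|_\infty\to0 \text{ as } t\downarrow 0\}$ and $D(\mathcal L_X^{n})=\{\varphi\in D(\mathcal L_X^{n-1}):\mathcal L_X^{n-1}\varphi\in D(\mathcal L_X)\}$ for $n\ge1$. **Intertwining.** Let $X$ and $U$ be diffusions on $\mathbb R^d$ and $\mathbb R^n$ which are intertwining: there is a measurable $\Lambda\ge0$ on $\mathbb R^n\times\mathbb R^d$ with $\int\Lambda(z,x)\,dx=1$ for every $z$, such that $L\varphi(z)=\int_{\mathbb R^d}\Lambda(z,x)\varphi(x)\,dx$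 satisfies $P^U_tL=LP^X_t$ on bounded measurable functions for all $t>0$. **Time process.** Let $Y=(Y_t)_{t\ge0}$ be a real-valued process with $Y_0=0$ a.s., independent of $X^x$ for every $x\in\mathbb R^d$ and of $U^x$ for every $x\in\mathbb R^n$. Let $p,q\ge0$ and $r\ge1$ be integers and let $\alpha_k,\beta_{i,j}$ be real functions of $t>0$. Assume: 1. for every $t>0$, $Y_t$ has a density $p_Y(t,\cdot)$; 2. for every $t>0$, $p_Y(t,\cdot)\in C^r(\mathbb R)$, and for $i\le q$, $j\le r$ the derivatives $\partial_t^i\partial_u^jp_Y$ exist on $(0,\infty)\times\mathbb R$ with $\partial_t^i\partial_u^jp_Y(t,\cdot)\in L^1(\mathbb R)$ for all $t>0$; 3. the even part $\mathcal E(t,u)=\frac12\big(p_Y(t,u)+p_Y(t,-u)\big)$ has time derivatives up to order $p$ and satisfies, for all $t>0$ and $u\in\mathbb R$, $$\sum_{k=1}^p\alpha_k(t)\,\partial_t^k\mathcal E(t,u)=\sum_{i=0}^q\sum_{j=1}^r\beta_{i,j}(t)\,\partial_t^i\partial_u^j\mathcal E(t,u);$$ 4. these time derivatives are also derivatives in $L^1(du)$: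 for $(i,j)$ with $i<p$, $j=0$, or with $i<q$, $j\le r$, and every $t>0$, the quotient $\big(\partial_t^i\partial_u^j\mathcal E(s,\cdot)-\partial_t^i\partial_u^j\mathcal E(t,\cdot)\big)/(s-t)$ converges to $\partial_t^{i+1}\partial_u^j\mathcal E(t,\cdot)$ in $L^1(\mathbb R)$ as $s\to t$. **Conclusion.** Let $f\in D(\mathcal L_X^{r-1})$, $g=Lf$ and $h(t,x)=\mathbb E\,g\big(U^x_{|Y_t|}\big)$. Then $h(t,\cdot)\in D(\mathcal L_U^{r-1})$ for all $t\ge0$, and $h(t,\cdot)\in D(\mathcal L_U^{r})$ for all $t>0$. For every $x\in\mathbb R^n$ the derivatives $\partial_t^kh(t,x)$ ($k\le p$) and $\partial_t^i\mathcal L_U^jh(t,x)$ ($i\le q$, $j\le r$) exist for $t>0$. On $(0,\infty)\times\mathbb R^n$, $$\sum_{k=1}^p\alpha_k(t)\,\partial_t^kh(t,x)=\sum_{i=0}^q\sum_{j=1}^r(-1)^j\beta_{i,j}(t)\,\partial_t^i\mathcal L_U^jh(t,x)+\mathcal B_g(t,x),$$ where $$\mathcal B_g(t,x)=2\sum_{i=0}^q\sum_{j=1}^r\beta_{i,j}(t)\sum_{0\le2k\le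 j-1}(-1)^{j-2k}\,\mathcal L_U^{j-1-2k}g(x)\;\partial_t^i\partial_u^{2k}p_Y(t,u)\Big|_{u=0}.$$ Moreover $h(0,\cdot)=g$. -/

import Mathlib

open MeasureTheory ProbabilityTheory Filter Topology
open scoped NNReal ENNReal

noncomputable section

namespace IteratedProcess

/-- A diffusion started from every point `x` of `E`, realised on one probability space: the family
of processes `X x = (X^x_t)_{t ≥ 0}` is time-homogeneous Markov (with respect to the natural
filtration of `X^x`, the transition probabilities `κ t` being Markov kernels on `E`) and has
almost surely continuous paths. -/
def IsDiffusion {Ω E : Type*} [MeasurableSpace Ω] [TopologicalSpace E] [MeasurableSpace E]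
    (μ : Measure Ω) (X : E → ℝ≥0 → Ω → E) : Prop :=
  (∀ x t, Measurable (X x t)) ∧
  (∀ x, ∀ᵐ ω ∂μ, X x 0 ω = x) ∧
  (∀ x, ∀ᵐ ω ∂μ, Continuous fun t => X x t ω) ∧
  ∃ κ : ℝ≥0 → Kernel E E, (∀ t, IsMarkovKernel (κ t)) ∧
    ∀ x s t, ∀ A : Set E, MeasurableSet A →
      μ[(X x (s + t) ⁻¹' A).indicator (fun _ => (1 : ℝ)) |
          ⨆ τ ∈ Set.Iic s, MeasurableSpace.comap (X x τ) inferInstance]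
        =ᵐ[μ] fun ω => (κ t (X x s ω)).real A

/-- The semigroup `P_t φ (x) = 𝔼 φ(X^x_t)`. -/
def semigroup {Ω E : Type*} [MeasurableSpace Ω] (μ : Measure Ω) (X : E → ℝ≥0 → Ω → E)
    (t : ℝ≥0) (φ : E → ℝ) (x : E) : ℝ :=
  ∫ ω, φ (X x t ω) ∂μ

/-- Bounded measurable functions. -/
def boundedFunctions (E : Type*) [MeasurableSpace E] : Set (E → ℝ) :=
  {φ | Measurable φ ∧ ∃ C, ∀ x, |φ x| ≤ C}

/-- The space `B₀` of bounded functions `φ` with `‖P_t φ - φ‖_∞ → 0` as `t ↓ 0`. -/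
def strongSpace {E : Type*} [MeasurableSpace E] (P : ℝ≥0 → (E → ℝ) → E → ℝ) : Set (E → ℝ) :=
  {φ ∈ boundedFunctions E | TendstoUniformly (fun t => P t φ) φ (𝓝[>] 0)}

/-- The domain of the infinitesimal generator: the bounded `φ` for which `(P_t φ - φ) / t`
converges in the sup norm as `t ↓ 0`. -/
def generatorDomain {E : Type*} [MeasurableSpace E] (P : ℝ≥0 → (E → ℝ) → E → ℝ) :
    Set (E → ℝ) :=
  {φ ∈ boundedFunctions E |
    ∃ w : E → ℝ, TendstoUniformly (fun (t : ℝ≥0) x => (P t φ x - φ x) / (t : ℝ)) w (𝓝[>] 0)}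

/-- The infinitesimal generator `𝓛 φ = lim_{t ↓ 0} (P_t φ - φ) / t` (meaningful on
`generatorDomain P`, where the limit exists uniformly). -/
def generator {E : Type*} (P : ℝ≥0 → (E → ℝ) → E → ℝ) (φ : E → ℝ) : E → ℝ :=
  fun x => limUnder (𝓝[>] (0 : ℝ≥0)) fun t => (P t φ x - φ x) / (t : ℝ)

/-- `D(𝓛⁰) = B₀` and `D(𝓛ⁿ⁺¹) = {φ ∈ D(𝓛ⁿ) : 𝓛ⁿ φ ∈ D(𝓛)}`. -/
def iterDomain {E : Type*} [MeasurableSpace E] (P : ℝ≥0 → (E → ℝ) → E → ℝ) :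
    ℕ → Set (E → ℝ)
  | 0 => strongSpace P
  | n + 1 => {φ ∈ iterDomain P n | (generator P)^[n] φ ∈ generatorDomain P}

/-- `∂_t^i ∂_u^j F (t, u)` (first `j` derivatives in `u`, then `i` in `t`). -/
def mixedDeriv (i j : ℕ) (F : ℝ → ℝ → ℝ) (t u : ℝ) : ℝ :=
  iteratedDeriv i (fun s => iteratedDeriv j (F s) u) t

/-- The even part in `u`. -/
def evenPart (F : ℝ → ℝ → ℝ) (t u : ℝ) : ℝ := (F t u + F t (-u)) / 2

/-- The assumptions on the time process `Y`: it starts from `0`, has for every `t > 0` the density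
`p t`, regular enough, and the even part of `p` satisfies the equation
`∑ₖ αₖ ∂_t^k E(p) = ∑ᵢ ∑ⱼ β_{i,j} ∂_t^i ∂_u^j E(p)`. -/
structure TimeProcess {Ω : Type*} [MeasurableSpace Ω] (μ : Measure Ω) (Y : ℝ≥0 → Ω → ℝ)
    (p : ℝ → ℝ → ℝ) (m q r : ℕ) (α : ℕ → ℝ → ℝ) (β : ℕ → ℕ → ℝ → ℝ) : Prop where
  measurable : ∀ t, Measurable (Y t)
  start : ∀ᵐ ω ∂μ, Y 0 ω = 0
  nonneg : ∀ t > 0, ∀ u, 0 ≤ p t u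
  density : ∀ t > 0,
    μ.map (Y (Real.toNNReal t)) = volume.withDensity fun u => ENNReal.ofReal (p t u)
  contDiff : ∀ t > 0, ContDiff ℝ r (p t)
  /-- The derivatives `∂_t^i ∂_u^j p`, `i ≤ q`, `j ≤ r`, exist. -/
  differentiable : ∀ i < q, ∀ j ≤ r, ∀ t > 0, ∀ u,
    DifferentiableAt ℝ (fun s => mixedDeriv i j p s u) t
  integrable : ∀ i ≤ q, ∀ j ≤ r, ∀ t > 0, Integrable (mixedDeriv i j p t)
  /-- The derivatives `∂_t^k E(p)`, `k ≤ m`, exist. -/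
  differentiable_even : ∀ k < m, ∀ t > 0, ∀ u,
    DifferentiableAt ℝ (fun s => mixedDeriv k 0 (evenPart p) s u) t
  /-- The time derivatives of the even part that occur in the equation are also derivatives
  in the sense of `L¹(du)`. -/
  deriv_L1 : ∀ i j, (i < m ∧ j = 0) ∨ (i < q ∧ j ≤ r) → ∀ t > 0,
    Tendsto (fun s => ∫⁻ u, ‖(mixedDeriv i j (evenPart p) s u - mixedDeriv i j (evenPart p) t u)
        / (s - t) - mixedDeriv (i + 1) j (evenPart p) t u‖ₑ) (𝓝[≠] t) (𝓝 0)
  equation : ∀ t > 0, ∀ u,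
    ∑ k ∈ Finset.Icc 1 m, α k t * mixedDeriv k 0 (evenPart p) t u =
      ∑ i ∈ Finset.range (q + 1), ∑ j ∈ Finset.Icc 1 r,
        β i j t * mixedDeriv i j (evenPart p) t u

/-- `Λ(z, ·)` is, measurably in `z`, a probability density. -/
def IsDensityKernel {E F : Type*} [MeasurableSpace E] [MeasureSpace F] (Λ : E → F → ℝ) : Prop :=
  Measurable (Function.uncurry Λ) ∧ (∀ z x, 0 ≤ Λ z x) ∧
    ∀ z, ∫⁻ x, ENNReal.ofReal (Λ z x) = 1

/-- `L φ (z) = ∫ Λ(z, x) φ(x) dx`. -/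
def kernelOp {E F : Type*} [MeasureSpace F] (Λ : E → F → ℝ) (φ : F → ℝ) (z : E) : ℝ :=
  ∫ x, Λ z x * φ x

/-- The semigroups `PX` and `PU` are intertwined by the density `Λ`: `PU_t L = L PX_t`, `t > 0`,
as operators on bounded functions. -/
def IsIntertwining {E F : Type*} [MeasurableSpace E] [MeasureSpace F]
    (PX : ℝ≥0 → (F → ℝ) → F → ℝ) (PU : ℝ≥0 → (E → ℝ) → E → ℝ) (Λ : E → F → ℝ) : Prop :=
  IsDensityKernel Λ ∧ ∀ t > 0, ∀ φ ∈ boundedFunctions F,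
    PU t (kernelOp Λ φ) = kernelOp Λ (PX t φ)

/-- `(t, x) ↦ 𝔼 φ(X^x(|Y_t|))`, for `t ≥ 0`. -/
def iteratedMean {Ω E : Type*} [MeasurableSpace Ω] (μ : Measure Ω) (X : E → ℝ≥0 → Ω → E)
    (Y : ℝ≥0 → Ω → ℝ) (φ : E → ℝ) (t : ℝ) (x : E) : ℝ :=
  ∫ ω, φ (X x (Real.nnabs (Y (Real.toNNReal t) ω)) ω) ∂μ

/-- The boundary term
`2 ∑ᵢ ∑ⱼ β_{i,j}(t) ∑_{0 ≤ 2k ≤ j-1} (-1)^{j-2k} A^{j-1-2k} φ(x) ∂_t^i ∂_u^{2k} p(t, 0)`. -/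
def boundaryTerm {E : Type*} (A : (E → ℝ) → E → ℝ) (p : ℝ → ℝ → ℝ) (q r : ℕ)
    (β : ℕ → ℕ → ℝ → ℝ) (φ : E → ℝ) (t : ℝ) (x : E) : ℝ :=
  2 * ∑ i ∈ Finset.range (q + 1), ∑ j ∈ Finset.Icc 1 r, β i j t *
    ∑ k ∈ (Finset.range j).filter (fun k => 2 * k ≤ j - 1),
      (-1) ^ (j - 2 * k) * A^[j - 1 - 2 * k] φ x * mixedDeriv i (2 * k) p t 0

end IteratedProcess

end

open IteratedProcess

/-! Write `P` for the semigroup of `U` and `E(t, ·)` for the even part of the density. Since `U` and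
`Y` are independent and only `|Y_t|` matters, for `t > 0` one has `h(t, x) = 2 ∫₀^∞ P_u g(x) E(t, u)
du` (`iteratedMean_eq_potential`). Everything is read off from this formula.

Time derivatives fall on `E`: `u ↦ P_u g(x)` is bounded, so derivatives of `E` in `L¹` pass through
the integral (`hasDerivAt_setIntegral_of_L1`). Integrating the equation for `E` against `P_u g(x)`
gives a relation between the integrals of `∂_t^k E` and of `∂_t^i ∂_u^j E`.

Space derivatives are traded for the generator by integration by parts: `𝓛 ∫ P_u φ k du = -k(0) φ -
∫ P_u φ k' du` (`hasGenerator_potential`). This needs only `φ ∈ B₀`, so averaging gains one order: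
from `g ∈ D(𝓛^{r-1})` follows `h(t, ·) ∈ D(𝓛^r)`. Iterating (`iterate_generator_potential`) produces
the factor `(-1)^j` and boundary values of `∂_u^l E` at `0`. For odd `l` these vanish; for even `l`
they are those of the density. This is the boundary term.

The intertwining serves only to show `g = Lf ∈ D(𝓛_U^{r-1})`: `L` is a sup-norm contraction, so it
carries the generator of `X` to that of `U`. -/

noncomputable section

namespace IteratedProcess

/-! ### Transition kernels of a diffusion -/

/-- `P` is the semigroup of operators of the Markov transition kernels `κ`. -/
structure IsTransitionSemigroup {E : Type*} [MeasurableSpace E] (κ : ℝ≥0 → Kernel E E)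
    (P : ℝ≥0 → (E → ℝ) → E → ℝ) : Prop where
  markov : ∀ t, IsMarkovKernel (κ t)
  apply : ∀ t φ x, Measurable φ → P t φ x = ∫ y, φ y ∂(κ t x)
  dirac : ∀ x, κ 0 x = Measure.dirac x
  comp : ∀ s t, κ (s + t) = κ t ∘ₖ κ s

/-- Taking expectations in the Markov property expresses the law at time `s + t` through that at
time `s`. With `s = 0` this identifies the law of `X^x_t` as `κ t x`; for general `s` it is then
Chapman–Kolmogorov. -/
theorem IsDiffusion.exists_isTransitionSemigroup {Ω E : Type*} [MeasurableSpace Ω]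
    [TopologicalSpace E] [MeasurableSpace E] {μ : Measure Ω} [IsProbabilityMeasure μ]
    {X : E → ℝ≥0 → Ω → E} (hX : IsDiffusion μ X) :
    ∃ κ, IsTransitionSemigroup κ (semigroup μ X) := by
  obtain ⟨hmeas, hstart, -, κ, hκ, hmarkov⟩ := hX
  have key : ∀ x s t A, MeasurableSet A →
      μ.real (X x (s + t) ⁻¹' A) = ∫ ω, (κ t (X x s ω)).real A ∂μ := by
    intro x s t A hA
    have hle : (⨆ τ ∈ Set.Iic s, MeasurableSpace.comap (X x τ) inferInstance) ≤
        (inferInstance : MeasurableSpace Ω) :=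
      iSup₂_le fun τ _ => (hmeas x τ).comap_le
    rw [← integral_congr_ae (hmarkov x s t A hA), integral_condExp hle,
      integral_indicator_const _ (hmeas x _ hA)]
    simp
  have hlaw : ∀ x t, μ.map (X x t) = κ t x := by
    intro x t
    have : IsProbabilityMeasure (μ.map (X x t)) :=
      Measure.isProbabilityMeasure_map (hmeas x t).aemeasurable
    refine Measure.ext fun A hA => ?_
    rw [← measureReal_eq_measureReal_iff, map_measureReal_apply (hmeas x t) hA]
    have h := key x 0 t A hA
    rw [zero_add] at h
    rw [h]
    have : (fun ω => (κ t (X x 0 ω)).real A) =ᵐ[μ] fun _ => (κ t x).real A := by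
      filter_upwards [hstart x] with ω hω
      rw [hω]
    rw [integral_congr_ae this]
    simp
  refine ⟨κ, hκ, fun t φ x hφ => ?_, fun x => ?_, fun s t => ?_⟩
  · rw [← hlaw, integral_map (hmeas x t).aemeasurable hφ.aestronglyMeasurable]
    rfl
  · rw [← hlaw, Measure.map_congr (hstart x), Measure.map_const]
    simp
  · refine Kernel.ext fun x => Measure.ext fun A hA => ?_
    rw [← measureReal_eq_measureReal_iff, ← hlaw x (s + t),
      map_measureReal_apply (hmeas x _) hA, key x s t A hA, measureReal_def,
      Kernel.comp_apply' _ _ _ hA, ← hlaw x s, lintegral_map ((κ t).measurable_coe hA) (hmeas x s),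
      ← integral_toReal]
    · rfl
    · exact (((κ t).measurable_coe hA).comp (hmeas x s)).aemeasurable
    · exact ae_of_all _ fun ω => measure_lt_top _ _

/-! ### Evaluation at an independent random time -/

section Randomization

variable {Ω E : Type*} [MeasurableSpace Ω] {μ : Measure Ω} [IsProbabilityMeasure μ]

/-- Rounding `s` up to a multiple of `1 / (k + 1)`. -/
def roundUp (k : ℕ) (s : ℝ≥0) : ℝ≥0 := (⌈s * (k + 1)⌉₊ : ℝ≥0) / (k + 1)

theorem tendsto_roundUp (s : ℝ≥0) : Tendsto (fun k => roundUp k s) atTop (𝓝 s) := by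
  have h1 : Tendsto (fun k : ℕ => s + 1 / ((k : ℝ≥0) + 1)) atTop (𝓝 s) := by
    simpa using tendsto_const_nhds.add (tendsto_one_div_add_atTop_nhds_zero_nat (𝕜 := ℝ≥0))
  refine tendsto_of_tendsto_of_tendsto_of_le_of_le tendsto_const_nhds h1 (fun k => ?_) fun k => ?_
  · rw [roundUp, le_div_iff₀ (by positivity)]
    exact Nat.le_ceil _
  · have hk : (0 : ℝ≥0) < (k : ℝ≥0) + 1 := by positivity
    simp only [roundUp]
    rw [div_le_iff₀ hk, add_mul, one_div, inv_mul_cancel₀ hk.ne']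
    exact (Nat.ceil_lt_add_one (by positivity)).le

/-- Evaluation of a path at a variable time is not jointly measurable for the product σ-algebra on
all paths. After rounding only countably many coordinates are read, and it becomes so. -/
theorem measurable_eval_roundUp [MeasurableSpace E] (k : ℕ) :
    Measurable fun z : (ℝ≥0 → E) × ℝ≥0 => z.1 (roundUp k z.2) := by
  have h1 : Measurable fun z : (ℝ≥0 → E) × ℕ => z.1 ((z.2 : ℝ≥0) / (k + 1)) :=
    measurable_from_prod_countable_left fun y => measurable_pi_apply ((y : ℝ≥0) / (k + 1))
  have h2 : Measurable fun z : (ℝ≥0 → E) × ℝ≥0 => (z.1, ⌈z.2 * ((k : ℝ≥0) + 1)⌉₊) :=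
    measurable_fst.prodMk (Nat.measurable_ceil.comp (measurable_snd.mul_const _))
  exact h1.comp h2

/-- A process with continuous paths, evaluated at an independent random time. -/
theorem integral_comp_indep_time [TopologicalSpace E] [TopologicalSpace.PseudoMetrizableSpace E]
    [MeasurableSpace E] [BorelSpace E] {X : ℝ≥0 → Ω → E} {T : Ω → ℝ≥0}
    (hX : ∀ t, Measurable (X t)) (hc : ∀ᵐ ω ∂μ, Continuous fun t => X t ω) (hT : Measurable T)
    (hXT : IndepFun (fun ω t => X t ω) T μ) {φ : E → ℝ} (hφ : φ ∈ boundedFunctions E) :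
    ∫ ω, φ (X (T ω) ω) ∂μ = ∫ ω, ∫ ω', φ (X (T ω) ω') ∂μ ∂μ := by
  have hpath : Measurable fun ω t => X t ω := measurable_pi_lambda _ hX
  have hpair : Measurable fun ω => ((fun t => X t ω), T ω) := hpath.prodMk hT
  have hpair' : Measurable fun z : Ω × Ω => ((fun t => X t z.2), T z.1) :=
    (hpath.comp measurable_snd).prodMk (hT.comp measurable_fst)
  have hlaw : μ.map (fun ω => ((fun t => X t ω), T ω)) =
      (μ.prod μ).map fun z : Ω × Ω => ((fun t => X t z.2), T z.1) := by
    rw [(indepFun_iff_map_prod_eq_prod_map_map hpath.aemeasurable hT.aemeasurable).1 hXT,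
      Measure.map_prod_map _ _ hpath hT]
    rw [← Measure.prod_swap (μ := μ) (ν := μ), Measure.map_map (by fun_prop) measurable_swap,
      Measure.prod_swap]
    rfl
  have hc' : ∀ᵐ z ∂(μ.prod μ), Continuous fun t => X t z.2 :=
    Measure.quasiMeasurePreserving_snd.ae hc
  have hlim : ∀ᵐ ω ∂μ, Tendsto (fun k => X (roundUp k (T ω)) ω) atTop (𝓝 (X (T ω) ω)) := by
    filter_upwards [hc] with ω hω
    exact (hω.tendsto _).comp (tendsto_roundUp _)
  have hlim' : ∀ᵐ z ∂(μ.prod μ),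
      Tendsto (fun k => X (roundUp k (T z.1)) z.2) atTop (𝓝 (X (T z.1) z.2)) := by
    filter_upwards [hc'] with z hz
    exact (hz.tendsto _).comp (tendsto_roundUp _)
  have hm : ∀ k, Measurable fun ω => X (roundUp k (T ω)) ω := fun k =>
    (measurable_eval_roundUp k).comp hpair
  have hm' : ∀ k, Measurable fun z : Ω × Ω => X (roundUp k (T z.1)) z.2 := fun k =>
    (measurable_eval_roundUp k).comp hpair'
  have ham : AEMeasurable (fun ω => X (T ω) ω) μ :=
    aemeasurable_of_tendsto_metrizable_ae' (fun k => (hm k).aemeasurable) hlim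
  have ham' : AEMeasurable (fun z : Ω × Ω => X (T z.1) z.2) (μ.prod μ) :=
    aemeasurable_of_tendsto_metrizable_ae' (fun k => (hm' k).aemeasurable) hlim'
  -- Equality of laws is first known for the rounded times. Paths converge as the rounding is
  -- refined, so the limit is taken against bounded continuous `ψ`; these determine the law, and `φ`
  -- may then be merely measurable.
  have hmap : μ.map (fun ω => X (T ω) ω) = (μ.prod μ).map fun z => X (T z.1) z.2 := by
    have := Measure.isProbabilityMeasure_map ham
    have := Measure.isProbabilityMeasure_map ham'
    refine ext_of_forall_integral_eq_of_IsFiniteMeasure fun ψ => ?_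
    have hψ : Continuous ψ := ψ.continuous
    rw [integral_map ham hψ.measurable.aestronglyMeasurable,
      integral_map ham' hψ.measurable.aestronglyMeasurable]
    have hdisc : ∀ k, ∫ ω, ψ (X (roundUp k (T ω)) ω) ∂μ =
        ∫ z : Ω × Ω, ψ (X (roundUp k (T z.1)) z.2) ∂(μ.prod μ) := by
      intro k
      have hk : Measurable fun z : (ℝ≥0 → E) × ℝ≥0 => ψ (z.1 (roundUp k z.2)) :=
        hψ.measurable.comp (measurable_eval_roundUp k)
      have e := congrArg (fun ν => ∫ z, ψ (z.1 (roundUp k z.2)) ∂ν) hlaw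
      beta_reduce at e
      rw [integral_map hpair.aemeasurable hk.aestronglyMeasurable,
        integral_map hpair'.aemeasurable hk.aestronglyMeasurable] at e
      exact e
    refine tendsto_nhds_unique (f := fun k => ∫ ω, ψ (X (roundUp k (T ω)) ω) ∂μ) (l := atTop)
      (tendsto_integral_of_dominated_convergence (fun _ => ‖ψ‖)
        (fun k => (hψ.measurable.comp (hm k)).aestronglyMeasurable) (integrable_const _)
        (fun k => ae_of_all _ fun ω => ψ.norm_coe_le_norm _) ?_) ?_
    · filter_upwards [hlim] with ω hω
      exact (hψ.tendsto _).comp hω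
    · simp_rw [hdisc]
      refine tendsto_integral_of_dominated_convergence (fun _ => ‖ψ‖)
        (fun k => (hψ.measurable.comp (hm' k)).aestronglyMeasurable) (integrable_const _)
        (fun k => ae_of_all _ fun ω => ψ.norm_coe_le_norm _) ?_
      filter_upwards [hlim'] with ω hω
      exact (hψ.tendsto _).comp hω
  obtain ⟨hφm, C, hC⟩ := hφ
  have e := congrArg (fun ν => ∫ z, φ z ∂ν) hmap
  beta_reduce at e
  rw [integral_map ham hφm.aestronglyMeasurable, integral_map ham' hφm.aestronglyMeasurable] at e
  rw [e, integral_prod]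
  exact Integrable.of_bound (hφm.comp_aemeasurable ham').aestronglyMeasurable C
    (ae_of_all _ fun z => hC _)

end Randomization

/-! ### Contraction semigroups, strong continuity and the generator -/

section Semigroup

variable {E : Type*} [MeasurableSpace E]

theorem boundedFunctions_add {φ ψ : E → ℝ} (hφ : φ ∈ boundedFunctions E)
    (hψ : ψ ∈ boundedFunctions E) : (fun x => φ x + ψ x) ∈ boundedFunctions E := by
  obtain ⟨hφm, C, hC⟩ := hφ
  obtain ⟨hψm, D, hD⟩ := hψ
  exact ⟨hφm.add hψm, C + D, fun x => (abs_add_le _ _).trans (add_le_add (hC x) (hD x))⟩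

theorem boundedFunctions_const_mul (c : ℝ) {φ : E → ℝ} (hφ : φ ∈ boundedFunctions E) :
    (fun x => c * φ x) ∈ boundedFunctions E := by
  obtain ⟨hφm, C, hC⟩ := hφ
  refine ⟨hφm.const_mul c, |c| * C, fun x => ?_⟩
  rw [abs_mul]
  exact mul_le_mul_of_nonneg_left (hC x) (abs_nonneg c)

theorem boundedFunctions_sub {φ ψ : E → ℝ} (hφ : φ ∈ boundedFunctions E)
    (hψ : ψ ∈ boundedFunctions E) : (fun x => φ x - ψ x) ∈ boundedFunctions E := by
  simpa [sub_eq_add_neg] using boundedFunctions_add hφ (boundedFunctions_const_mul (-1) hψ)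

theorem integrable_of_mem_boundedFunctions {φ : E → ℝ} (hφ : φ ∈ boundedFunctions E)
    (ν : Measure E) [IsFiniteMeasure ν] : Integrable φ ν := by
  obtain ⟨hφm, C, hC⟩ := hφ
  exact Integrable.of_bound hφm.aestronglyMeasurable C (ae_of_all _ hC)

/-- The sup-norm limit of bounded measurable functions is bounded and measurable. -/
theorem boundedFunctions_of_tendstoUniformly {ι : Type*} {l : Filter ι} [l.NeBot]
    [l.IsCountablyGenerated] {F : ι → E → ℝ} {w : E → ℝ} (hF : ∀ i, F i ∈ boundedFunctions E)
    (h : TendstoUniformly F w l) : w ∈ boundedFunctions E := by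
  refine ⟨measurable_of_tendsto_metrizable' l (fun i => (hF i).1)
    (tendsto_pi_nhds.2 fun x => h.tendsto_at x), ?_⟩
  obtain ⟨i, hi⟩ := (Metric.tendstoUniformly_iff.1 h 1 one_pos).exists
  obtain ⟨-, C, hC⟩ := hF i
  refine ⟨1 + C, fun x => ?_⟩
  have h1 := (hi x).le
  rw [Real.dist_eq] at h1
  calc |w x| = |(w x - F i x) + F i x| := by ring_nf
    _ ≤ _ := (abs_add_le _ _).trans (add_le_add h1 (hC x))

namespace IsTransitionSemigroup

variable {κ : ℝ≥0 → Kernel E E} {P : ℝ≥0 → (E → ℝ) → E → ℝ}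

theorem abs_apply_le (hP : IsTransitionSemigroup κ P) (t : ℝ≥0) {φ : E → ℝ} (hφ : Measurable φ)
    {C : ℝ} (hC : ∀ x, |φ x| ≤ C) (x : E) : |P t φ x| ≤ C := by
  have := hP.markov t
  rw [hP.apply t φ x hφ]
  simpa using norm_integral_le_of_norm_le_const (μ := κ t x) (f := φ) (C := C) (ae_of_all _ hC)

theorem apply_mem (hP : IsTransitionSemigroup κ P) (t : ℝ≥0) {φ : E → ℝ}
    (hφ : φ ∈ boundedFunctions E) : P t φ ∈ boundedFunctions E := by
  have := hP.markov t
  obtain ⟨hφm, C, hC⟩ := hφ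
  refine ⟨?_, C, hP.abs_apply_le t hφm hC⟩
  have : P t φ = fun x => ∫ y, φ y ∂(κ t x) := funext fun x => hP.apply t φ x hφm
  rw [this]
  exact (hφm.stronglyMeasurable.integral_kernel (κ := κ t)).measurable

theorem apply_add (hP : IsTransitionSemigroup κ P) (t : ℝ≥0) {φ ψ : E → ℝ}
    (hφ : φ ∈ boundedFunctions E) (hψ : ψ ∈ boundedFunctions E) (x : E) :
    P t (fun y => φ y + ψ y) x = P t φ x + P t ψ x := by
  have := hP.markov t
  rw [hP.apply _ _ _ hφ.1, hP.apply _ _ _ hψ.1, hP.apply _ _ _ (boundedFunctions_add hφ hψ).1,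
    integral_add (integrable_of_mem_boundedFunctions hφ _)
      (integrable_of_mem_boundedFunctions hψ _)]

theorem apply_const_mul (hP : IsTransitionSemigroup κ P) (t : ℝ≥0) (c : ℝ) {φ : E → ℝ}
    (hφ : φ ∈ boundedFunctions E) (x : E) : P t (fun y => c * φ y) x = c * P t φ x := by
  rw [hP.apply _ _ _ hφ.1, hP.apply _ _ _ (hφ.1.const_mul c), integral_const_mul]

theorem apply_sub (hP : IsTransitionSemigroup κ P) (t : ℝ≥0) {φ ψ : E → ℝ}
    (hφ : φ ∈ boundedFunctions E) (hψ : ψ ∈ boundedFunctions E) (x : E) :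
    P t (fun y => φ y - ψ y) x = P t φ x - P t ψ x := by
  have := hP.markov t
  rw [hP.apply _ _ _ hφ.1, hP.apply _ _ _ hψ.1, hP.apply _ _ _ (boundedFunctions_sub hφ hψ).1,
    integral_sub (integrable_of_mem_boundedFunctions hφ _)
      (integrable_of_mem_boundedFunctions hψ _)]

theorem apply_zero (hP : IsTransitionSemigroup κ P) {φ : E → ℝ} (hφ : Measurable φ) (x : E) :
    P 0 φ x = φ x := by
  rw [hP.apply _ _ _ hφ, hP.dirac, integral_dirac' _ _ hφ.stronglyMeasurable]

theorem apply_apply (hP : IsTransitionSemigroup κ P) (s t : ℝ≥0) {φ : E → ℝ}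
    (hφ : φ ∈ boundedFunctions E) : P s (P t φ) = P (s + t) φ := by
  have := hP.markov t
  have := hP.markov s
  have := hP.markov (s + t)
  funext x
  rw [hP.apply _ _ _ (hP.apply_mem t hφ).1, hP.apply _ _ _ hφ.1, hP.comp, Kernel.integral_comp]
  · exact integral_congr_ae (ae_of_all _ fun y => hP.apply _ _ _ hφ.1)
  · exact integrable_of_mem_boundedFunctions hφ _

/-- Apply the contraction `P_s` to `P_t φ - φ`: the modulus of continuity at time `0` is valid at
every time. -/
theorem abs_apply_sub_le (hP : IsTransitionSemigroup κ P) (s t : ℝ≥0) {φ : E → ℝ}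
    (hφ : φ ∈ boundedFunctions E) {C : ℝ} (hC : ∀ x, |P t φ x - φ x| ≤ C) (x : E) :
    |P (s + t) φ x - P s φ x| ≤ C := by
  rw [← hP.apply_apply s t hφ, ← hP.apply_sub s (hP.apply_mem t hφ) hφ]
  exact hP.abs_apply_le s ((hP.apply_mem t hφ).1.sub hφ.1) hC x

theorem exists_modulus (hP : IsTransitionSemigroup κ P) {φ : E → ℝ} (hφ : φ ∈ strongSpace P)
    {ε : ℝ} (hε : 0 < ε) : ∃ δ > 0, ∀ t < δ, ∀ x, |P t φ x - φ x| ≤ ε := by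
  have h := Metric.tendstoUniformly_iff.1 hφ.2 ε hε
  obtain ⟨δ, hδ, h⟩ := (nhdsGT_basis (0 : ℝ≥0)).eventually_iff.1 h
  refine ⟨δ, hδ, fun t ht x => ?_⟩
  rcases eq_or_ne t 0 with rfl | h0
  · rw [hP.apply_zero hφ.1.1]
    simpa using hε.le
  · have := (h ⟨pos_iff_ne_zero.2 h0, ht⟩ x).le
    rwa [dist_comm, Real.dist_eq] at this

theorem mem_strongSpace_of_modulus {φ : E → ℝ} (hφ : φ ∈ boundedFunctions E)
    (h : ∀ ε > 0, ∃ δ > 0, ∀ t < δ, ∀ x, |P t φ x - φ x| ≤ ε) : φ ∈ strongSpace P := by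
  refine ⟨hφ, Metric.tendstoUniformly_iff.2 fun ε hε => ?_⟩
  obtain ⟨δ, hδ, h⟩ := h (ε / 2) (half_pos hε)
  refine (nhdsGT_basis (0 : ℝ≥0)).eventually_iff.2 ⟨δ, hδ, fun t ht x => ?_⟩
  rw [dist_comm, Real.dist_eq]
  exact (h t ht.2 x).trans_lt (half_lt_self hε)

theorem continuous_apply (hP : IsTransitionSemigroup κ P) {φ : E → ℝ} (hφ : φ ∈ strongSpace P)
    (x : E) : Continuous fun t => P t φ x := by
  refine Metric.continuous_iff.2 fun t ε hε => ?_
  obtain ⟨δ, hδ, h⟩ := hP.exists_modulus hφ (half_pos hε)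
  refine ⟨δ, hδ, fun s hs => ?_⟩
  rw [NNReal.dist_eq] at hs
  rw [Real.dist_eq]
  refine lt_of_le_of_lt ?_ (half_lt_self hε)
  rcases le_total s t with hst | hst
  · obtain ⟨v, rfl⟩ := exists_add_of_le hst
    rw [abs_sub_comm]
    refine hP.abs_apply_sub_le s v hφ.1 (h v ?_) x
    simpa using hs
  · obtain ⟨v, rfl⟩ := exists_add_of_le hst
    refine hP.abs_apply_sub_le t v hφ.1 (h v ?_) x
    simpa using hs

theorem continuous_apply_toNNReal (hP : IsTransitionSemigroup κ P) {φ : E → ℝ}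
    (hφ : φ ∈ strongSpace P) (x : E) : Continuous fun u : ℝ => P u.toNNReal φ x :=
  (hP.continuous_apply hφ x).comp continuous_real_toNNReal

theorem strongSpace_add (hP : IsTransitionSemigroup κ P) {φ ψ : E → ℝ} (hφ : φ ∈ strongSpace P)
    (hψ : ψ ∈ strongSpace P) : (fun x => φ x + ψ x) ∈ strongSpace P := by
  refine mem_strongSpace_of_modulus (boundedFunctions_add hφ.1 hψ.1) fun ε hε => ?_
  obtain ⟨δ, hδ, h⟩ := hP.exists_modulus hφ (half_pos hε)
  obtain ⟨δ', hδ', h'⟩ := hP.exists_modulus hψ (half_pos hε)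
  refine ⟨min δ δ', lt_min hδ hδ', fun t ht x => ?_⟩
  rw [hP.apply_add t hφ.1 hψ.1]
  have h1 := h t (ht.trans_le (min_le_left _ _)) x
  have h2 := h' t (ht.trans_le (min_le_right _ _)) x
  rw [abs_le] at *
  constructor <;> linarith

theorem strongSpace_const_mul (hP : IsTransitionSemigroup κ P) (c : ℝ) {φ : E → ℝ}
    (hφ : φ ∈ strongSpace P) : (fun x => c * φ x) ∈ strongSpace P := by
  refine mem_strongSpace_of_modulus (boundedFunctions_const_mul c hφ.1) fun ε hε => ?_
  obtain ⟨δ, hδ, h⟩ := hP.exists_modulus hφ (ε := ε / (|c| + 1)) (by positivity)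
  refine ⟨δ, hδ, fun t ht x => ?_⟩
  rw [hP.apply_const_mul t c hφ.1, ← mul_sub, abs_mul]
  calc |c| * |P t φ x - φ x| ≤ (|c| + 1) * (ε / (|c| + 1)) :=
        mul_le_mul (by linarith) (h t ht x) (abs_nonneg _) (by positivity)
    _ = ε := by field_simp

end IsTransitionSemigroup

/-- `(P_t φ - φ) / t` converges to `w` in the sup norm as `t ↓ 0`. -/
def HasGenerator (P : ℝ≥0 → (E → ℝ) → E → ℝ) (φ w : E → ℝ) : Prop :=
  TendstoUniformly (fun (t : ℝ≥0) x => (P t φ x - φ x) / (t : ℝ)) w (𝓝[>] 0)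

/-- Since `generator` is a pointwise `limUnder`, it carries information only once a limit is
exhibited; this passes from the relation to the function. -/
theorem HasGenerator.generator_eq {F : Type*} {P : ℝ≥0 → (F → ℝ) → F → ℝ} {φ w : F → ℝ}
    (h : HasGenerator P φ w) : generator P φ = w :=
  funext fun x => (h.tendsto_at x).limUnder_eq

theorem hasGenerator_of_mem_generatorDomain {P : ℝ≥0 → (E → ℝ) → E → ℝ} {φ : E → ℝ}
    (h : φ ∈ generatorDomain P) : HasGenerator P φ (generator P φ) := by
  obtain ⟨-, w, hw⟩ := h
  have hw : HasGenerator P φ w := hw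
  rwa [hw.generator_eq]

namespace HasGenerator

variable {κ : ℝ≥0 → Kernel E E} {P : ℝ≥0 → (E → ℝ) → E → ℝ} {φ ψ v w : E → ℝ}

theorem add (hP : IsTransitionSemigroup κ P) (hφ : φ ∈ boundedFunctions E)
    (hψ : ψ ∈ boundedFunctions E) (h : HasGenerator P φ v) (h' : HasGenerator P ψ w) :
    HasGenerator P (fun x => φ x + ψ x) fun x => v x + w x := by
  have hadd : TendstoUniformly _ (fun x => v x + w x) _ := TendstoUniformly.add h h'
  unfold HasGenerator
  convert hadd using 1
  funext t x
  simp only [Pi.add_apply, hP.apply_add t hφ hψ]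
  ring

theorem const_mul (hP : IsTransitionSemigroup κ P) (c : ℝ) (hφ : φ ∈ boundedFunctions E)
    (h : HasGenerator P φ v) : HasGenerator P (fun x => c * φ x) fun x => c * v x := by
  have hmul : TendstoUniformly _ (fun x => c * v x) _ :=
    (uniformContinuous_const_smul c).comp_tendstoUniformly h
  unfold HasGenerator
  convert hmul using 1
  funext t x
  simp only [Function.comp_apply, smul_eq_mul, hP.apply_const_mul t c hφ]
  ring

theorem sum (hP : IsTransitionSemigroup κ P) {ι : Type*} (s : Finset ι) {c : ι → ℝ}
    {φ v : ι → E → ℝ} (hφ : ∀ i ∈ s, φ i ∈ boundedFunctions E)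
    (h : ∀ i ∈ s, HasGenerator P (φ i) (v i)) :
    (fun x => ∑ i ∈ s, c i * φ i x) ∈ boundedFunctions E ∧
      HasGenerator P (fun x => ∑ i ∈ s, c i * φ i x) fun x => ∑ i ∈ s, c i * v i x := by
  classical
  induction s using Finset.induction_on with
  | empty =>
    have h0 : (fun _ : E => (0 : ℝ)) ∈ boundedFunctions E := ⟨measurable_const, 0, by simp⟩
    refine ⟨by simpa using h0, ?_⟩
    refine Metric.tendstoUniformly_iff.2 fun ε hε => Eventually.of_forall fun t x => ?_
    have : P t (fun _ => 0) x = 0 := by simpa using hP.apply_const_mul t 0 h0 x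
    simpa [this] using hε
  | insert a s ha ih =>
    obtain ⟨ih1, ih2⟩ := ih (fun i hi => hφ i (Finset.mem_insert_of_mem hi))
      (fun i hi => h i (Finset.mem_insert_of_mem hi))
    have hb := boundedFunctions_const_mul (c a) (hφ a (Finset.mem_insert_self a s))
    have hg := (h a (Finset.mem_insert_self a s)).const_mul hP (c a)
      (hφ a (Finset.mem_insert_self a s))
    simp only [Finset.sum_insert ha]
    exact ⟨boundedFunctions_add hb ih1, hg.add hP hb ih1 ih2⟩

theorem mem_boundedFunctions (hP : IsTransitionSemigroup κ P) (hφ : φ ∈ boundedFunctions E)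
    (h : HasGenerator P φ w) : w ∈ boundedFunctions E := by
  refine boundedFunctions_of_tendstoUniformly (fun t => ?_) h
  have := boundedFunctions_const_mul (t : ℝ)⁻¹ (boundedFunctions_sub (hP.apply_mem t hφ) hφ)
  simpa only [div_eq_inv_mul] using this

/-- If `P_s ψ - ψ = ∫₀ˢ P_v χ dv` with `χ ∈ B₀`, then `ψ` is in the domain and `𝓛 ψ = χ`. -/
theorem of_integral (hP : IsTransitionSemigroup κ P) {ψ χ : E → ℝ} (hχ : χ ∈ strongSpace P)
    (h : ∀ (s : ℝ≥0) x, P s ψ x - ψ x = ∫ v in (0 : ℝ)..s, P v.toNNReal χ x) :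
    HasGenerator P ψ χ := by
  refine Metric.tendstoUniformly_iff.2 fun ε hε => ?_
  obtain ⟨δ, hδ, hd⟩ := hP.exists_modulus hχ (half_pos hε)
  refine (nhdsGT_basis (0 : ℝ≥0)).eventually_iff.2 ⟨δ, hδ, fun s hs x => ?_⟩
  have hpos : (0 : ℝ) < s := NNReal.coe_pos.2 hs.1
  have hc := hP.continuous_apply_toNNReal hχ x
  rw [dist_comm, Real.dist_eq, h]
  -- The error is the mean over `[0, s]` of `P_v χ - χ`, which the modulus at `0` bounds uniformly
  -- in `x`.
  have e : (∫ v in (0 : ℝ)..s, P v.toNNReal χ x) / s - χ x =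
      (∫ v in (0 : ℝ)..s, (P v.toNNReal χ x - χ x)) / s := by
    rw [intervalIntegral.integral_sub (hc.intervalIntegrable _ _) (by simp)]
    simp only [intervalIntegral.integral_const, smul_eq_mul, sub_zero]
    field_simp
  rw [e, abs_div, abs_of_pos hpos]
  refine lt_of_le_of_lt ?_ (half_lt_self hε)
  rw [div_le_iff₀ hpos]
  have hb := intervalIntegral.norm_integral_le_of_norm_le_const (a := (0 : ℝ)) (b := s)
    (f := fun v => P v.toNNReal χ x - χ x) (C := ε / 2) fun v hv => by
      rw [Set.uIoc_of_le hpos.le] at hv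
      refine hd _ (lt_of_le_of_lt ?_ hs.2) x
      exact Real.toNNReal_le_iff_le_coe.2 hv.2
  simpa [abs_of_pos hpos] using hb

end HasGenerator

end Semigroup

/-! ### Weighted averages of the semigroup over the half-line -/

section Potential

/-- Integration by parts, for a bounded continuous `F` averaged over windows of length `s`. -/
theorem integral_shift_sub_eq {F k k' : ℝ → ℝ} {C : ℝ} (hF : Continuous F) (hC : ∀ u, |F u| ≤ C)
    (hk : ∀ u, HasDerivAt k (k' u) u) (hk' : Continuous k')
    (hki : IntegrableOn k (Set.Ioi 0)) (hki' : IntegrableOn k' (Set.Ioi 0)) {s : ℝ} (hs : 0 ≤ s) :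
    (∫ u in Set.Ioi 0, F (u + s) * k u) - ∫ u in Set.Ioi 0, F u * k u =
      ∫ v in 0..s, (-(k 0 * F v) - ∫ u in Set.Ioi 0, F (u + v) * k' u) := by
  have hkc : Continuous k := continuous_iff_continuousAt.2 fun u => (hk u).continuousAt
  have hint : ∀ {l : ℝ → ℝ} (v : ℝ), IntegrableOn l (Set.Ioi 0) →
      IntegrableOn (fun u => F (u + v) * l u) (Set.Ioi 0) := fun v hl =>
    hl.bdd_mul (c := C) (by fun_prop) (ae_of_all _ fun u => hC _)
  have hswap : ∫ v in (0 : ℝ)..s, ∫ u in Set.Ioi 0, F (u + v) * k' u =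
      ∫ u in Set.Ioi 0, ∫ v in (0 : ℝ)..s, F (u + v) * k' u := by
    refine intervalIntegral_integral_swap (f := fun v u => F (u + v) * k' u) ?_
    have : IsFiniteMeasure ((volume : Measure ℝ).restrict (Set.uIoc 0 s)) :=
      ⟨by rw [Measure.restrict_apply_univ]; exact measure_Ioc_lt_top⟩
    have h1 : Integrable (fun z : ℝ × ℝ => k' z.2)
        ((volume.restrict (Set.uIoc 0 s)).prod (volume.restrict (Set.Ioi 0))) :=
      hki'.comp_snd _
    refine h1.bdd_mul (f := fun z : ℝ × ℝ => F (z.2 + z.1)) (c := C)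
      (by fun_prop) (ae_of_all _ fun z => hC _)
  have hparam : Continuous fun v => ∫ u in Set.Ioi 0, F (u + v) * k' u := by
    refine continuous_of_dominated (bound := fun u => C * |k' u|) (fun v => by fun_prop)
      (fun v => ae_of_all _ fun u => ?_) (hki'.abs.const_mul C) (ae_of_all _ fun u => by fun_prop)
    rw [norm_mul]
    exact mul_le_mul_of_nonneg_right (hC _) (abs_nonneg _)
  -- `F` need not be differentiable, but its integral over a window of length `s` is, with
  -- derivative `F (u + s) - F u`. The integration by parts is done with this primitive.
  set W : ℝ → ℝ := fun u => ∫ v in (0 : ℝ)..s, F (u + v) with hW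
  have hWeq : ∀ u, W u = (∫ v in (0 : ℝ)..(u + s), F v) - ∫ v in (0 : ℝ)..u, F v := by
    intro u
    rw [hW]
    simp only [intervalIntegral.integral_comp_add_left, add_zero]
    rw [intervalIntegral.integral_interval_sub_left (hF.intervalIntegrable _ _)
      (hF.intervalIntegrable _ _)]
  have hWd : ∀ u, HasDerivAt W (F (u + s) - F u) u := by
    intro u
    have hG : ∀ a, HasDerivAt (fun b => ∫ v in (0 : ℝ)..b, F v) (F a) a := fun a =>
      intervalIntegral.integral_hasDerivAt_right (hF.intervalIntegrable _ _)
        (hF.stronglyMeasurableAtFilter _ _) hF.continuousAt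
    rw [funext hWeq]
    exact ((hG (u + s)).comp_add_const u s).sub (hG u)
  have hWc : Continuous W := continuous_iff_continuousAt.2 fun u => (hWd u).continuousAt
  have hWb : ∀ u, |W u| ≤ C * s := by
    intro u
    have := intervalIntegral.norm_integral_le_of_norm_le_const (a := (0 : ℝ)) (b := s)
      (f := fun v => F (u + v)) (C := C) fun v _ => hC _
    rwa [sub_zero, abs_of_nonneg hs] at this
  -- No boundary term arises at infinity: `k` and `k'` are integrable, so `k` tends to `0`, and `W`
  -- is bounded.
  have hlim : Tendsto (W * k) atTop (𝓝 0) := by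
    have hk0 := tendsto_zero_of_hasDerivAt_of_integrableOn_Ioi (fun u _ => hk u) hki' hki
    refine bdd_le_mul_tendsto_zero' (C * s) (Eventually.of_forall hWb) hk0
  have hlim0 : Tendsto (W * k) (𝓝[>] 0) (𝓝 (W 0 * k 0)) :=
    ((hWc.mul hkc).tendsto 0).mono_left nhdsWithin_le_nhds
  have hparts := integral_Ioi_mul_deriv_eq_deriv_mul (u := W) (v := k) (fun u _ => hWd u)
    (fun u _ => hk u)
    (hki'.bdd_mul (c := C * s) (by fun_prop) (ae_of_all _ fun u => hWb _))
    (by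
      have := (hint s hki).sub (hint 0 hki)
      refine this.congr (ae_of_all _ fun u => ?_)
      simp [sub_mul])
    hlim0 hlim
  have hW0 : W 0 = ∫ v in (0 : ℝ)..s, F v := by simp [hW]
  have hsub : ∫ u in Set.Ioi 0, (F (u + s) - F u) * k u =
      (∫ u in Set.Ioi 0, F (u + s) * k u) - ∫ u in Set.Ioi 0, F u * k u := by
    rw [← integral_sub (hint s hki) (by simpa [IntegrableOn] using hint 0 hki)]
    simp only [sub_mul]
  rw [intervalIntegral.integral_sub, hswap]
  · simp only [intervalIntegral.integral_mul_const, intervalIntegral.integral_neg,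
      intervalIntegral.integral_const_mul]
    rw [← hW0, ← hsub]
    linarith
  · exact Continuous.intervalIntegrable (by fun_prop) _ _
  · exact hparam.intervalIntegrable _ _

variable {E : Type*} [MeasurableSpace E]

/-- `∫₀^∞ P_u φ k(u) du`. -/
def potential (P : ℝ≥0 → (E → ℝ) → E → ℝ) (φ : E → ℝ) (k : ℝ → ℝ) (x : E) : ℝ :=
  ∫ u in Set.Ioi (0 : ℝ), P u.toNNReal φ x * k u

namespace IsTransitionSemigroup

variable {κ : ℝ≥0 → Kernel E E} {P : ℝ≥0 → (E → ℝ) → E → ℝ} {φ : E → ℝ} {k k' : ℝ → ℝ}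

theorem integrable_apply_add_mul (hP : IsTransitionSemigroup κ P) (hφ : φ ∈ strongSpace P)
    (hki : IntegrableOn k (Set.Ioi 0)) (s : ℝ≥0) (x : E) :
    IntegrableOn (fun u : ℝ => P (u.toNNReal + s) φ x * k u) (Set.Ioi 0) := by
  obtain ⟨C, hC⟩ := hφ.1.2
  have hc : Continuous fun u : ℝ => P (u.toNNReal + s) φ x :=
    (hP.continuous_apply hφ x).comp (continuous_real_toNNReal.add continuous_const)
  exact hki.bdd_mul (c := C) hc.aestronglyMeasurable
    (ae_of_all _ fun u => hP.abs_apply_le _ hφ.1.1 hC x)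

theorem integrable_apply_mul (hP : IsTransitionSemigroup κ P) (hφ : φ ∈ strongSpace P)
    (hki : IntegrableOn k (Set.Ioi 0)) (x : E) :
    IntegrableOn (fun u : ℝ => P u.toNNReal φ x * k u) (Set.Ioi 0) := by
  simpa using hP.integrable_apply_add_mul hφ hki 0 x

theorem measurable_apply_mul (hP : IsTransitionSemigroup κ P) (hφ : φ ∈ strongSpace P)
    (hk : Measurable k) :
    Measurable fun z : E × ℝ => P z.2.toNNReal φ z.1 * k z.2 := by
  have := measurable_uncurry_of_continuous_of_measurable (u := fun (u : ℝ) x => P u.toNNReal φ x)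
    (hP.continuous_apply_toNNReal hφ) fun u => (hP.apply_mem _ hφ.1).1
  exact (this.comp measurable_swap).mul (hk.comp measurable_snd)

theorem potential_mem (hP : IsTransitionSemigroup κ P) (hφ : φ ∈ strongSpace P)
    (hk : Measurable k) (hki : IntegrableOn k (Set.Ioi 0)) :
    potential P φ k ∈ boundedFunctions E := by
  obtain ⟨C, hC⟩ := hφ.1.2
  refine ⟨(StronglyMeasurable.integral_prod_right'
    (hP.measurable_apply_mul hφ hk).stronglyMeasurable).measurable,
    ∫ u in Set.Ioi (0 : ℝ), C * |k u|, fun x => ?_⟩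
  rw [← Real.norm_eq_abs]
  refine norm_integral_le_of_norm_le (hki.abs.const_mul C) (ae_of_all _ fun u => ?_)
  rw [norm_mul]
  exact mul_le_mul_of_nonneg_right (hP.abs_apply_le _ hφ.1.1 hC x) (abs_nonneg _)

theorem apply_potential (hP : IsTransitionSemigroup κ P) (hφ : φ ∈ strongSpace P)
    (hk : Measurable k) (hki : IntegrableOn k (Set.Ioi 0)) (s : ℝ≥0) (x : E) :
    P s (potential P φ k) x = ∫ u in Set.Ioi (0 : ℝ), P (u.toNNReal + s) φ x * k u := by
  have := hP.markov s
  obtain ⟨C, hC⟩ := hφ.1.2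
  rw [hP.apply _ _ _ (hP.potential_mem hφ hk hki).1]
  unfold potential
  rw [integral_integral_swap]
  · refine integral_congr_ae (ae_of_all _ fun u => ?_)
    simp only
    rw [integral_mul_const, ← hP.apply _ _ _ (hP.apply_mem _ hφ.1).1, hP.apply_apply _ _ hφ.1,
      add_comm]
  · have h1 : Integrable (fun z : E × ℝ => C * |k z.2|)
        ((κ s x).prod (volume.restrict (Set.Ioi 0))) := (hki.abs.const_mul C).comp_snd _
    refine h1.mono' (hP.measurable_apply_mul hφ hk).aestronglyMeasurable (ae_of_all _ fun z => ?_)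
    rw [Function.uncurry, norm_mul]
    exact mul_le_mul_of_nonneg_right (hP.abs_apply_le _ hφ.1.1 hC _) (abs_nonneg _)

theorem potential_mem_strongSpace (hP : IsTransitionSemigroup κ P) (hφ : φ ∈ strongSpace P)
    (hk : Measurable k) (hki : IntegrableOn k (Set.Ioi 0)) :
    potential P φ k ∈ strongSpace P := by
  refine mem_strongSpace_of_modulus (hP.potential_mem hφ hk hki) fun ε hε => ?_
  set K := ∫ u in Set.Ioi (0 : ℝ), |k u|
  have hK : 0 ≤ K := integral_nonneg fun u => abs_nonneg _
  obtain ⟨δ, hδ, h⟩ := hP.exists_modulus hφ (ε := ε / (K + 1)) (by positivity)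
  refine ⟨δ, hδ, fun t ht x => ?_⟩
  rw [hP.apply_potential hφ hk hki, potential,
    ← integral_sub (hP.integrable_apply_add_mul hφ hki t x) (hP.integrable_apply_mul hφ hki x)]
  calc _ ≤ ∫ u in Set.Ioi (0 : ℝ), ε / (K + 1) * |k u| := by
        rw [← Real.norm_eq_abs]
        refine norm_integral_le_of_norm_le (hki.abs.const_mul _) (ae_of_all _ fun u => ?_)
        rw [← sub_mul, norm_mul]
        exact mul_le_mul_of_nonneg_right (hP.abs_apply_sub_le _ _ hφ.1 (h t ht) x) (abs_nonneg _)
    _ = ε / (K + 1) * K := integral_const_mul _ _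
    _ ≤ ε / (K + 1) * (K + 1) := by gcongr; linarith
    _ = ε := by field_simp

/-- Applying `P_s` shifts the semigroup inside the average by `s`. By `integral_shift_sub_eq` the
increment is the integral over `[0, s]` of `P_v` applied to the claimed image, which lies in `B₀`,
so `HasGenerator.of_integral` applies. No differentiability of `u ↦ P_u φ` is required. -/
theorem hasGenerator_potential (hP : IsTransitionSemigroup κ P) (hφ : φ ∈ strongSpace P)
    (hk : ∀ u, HasDerivAt k (k' u) u) (hk' : Continuous k')
    (hki : IntegrableOn k (Set.Ioi 0)) (hki' : IntegrableOn k' (Set.Ioi 0)) :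
    HasGenerator P (potential P φ k) fun x => -k 0 * φ x + -1 * potential P φ k' x := by
  have hkc : Continuous k := continuous_iff_continuousAt.2 fun u => (hk u).continuousAt
  have hpot := hP.potential_mem_strongSpace hφ hk'.measurable hki'
  have hφ0 := hP.strongSpace_const_mul (-k 0) hφ
  have hpot' := hP.strongSpace_const_mul (-1) hpot
  refine HasGenerator.of_integral hP (hP.strongSpace_add hφ0 hpot') fun s x => ?_
  obtain ⟨C, hC⟩ := hφ.1.2
  have hshift : ∀ (l : ℝ → ℝ) (v : ℝ), 0 ≤ v → ∫ u in Set.Ioi (0 : ℝ),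
      P (u.toNNReal + v.toNNReal) φ x * l u =
        ∫ u in Set.Ioi (0 : ℝ), P (u + v).toNNReal φ x * l u := by
    intro l v hv
    refine setIntegral_congr_fun measurableSet_Ioi fun u hu => ?_
    rw [Real.toNNReal_add (le_of_lt hu) hv]
  have key := integral_shift_sub_eq (hP.continuous_apply_toNNReal hφ x)
    (fun u => hP.abs_apply_le _ hφ.1.1 hC x) hk hk' hki hki' s.2
  rw [hP.apply_potential hφ hkc.measurable hki]
  have h1 := hshift k s s.2
  rw [Real.toNNReal_coe] at h1
  rw [h1]
  refine key.trans (intervalIntegral.integral_congr fun v hv => ?_)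
  rw [Set.uIcc_of_le s.2] at hv
  rw [← hshift k' v hv.1, hP.apply_add _ hφ0.1 hpot'.1, hP.apply_const_mul _ _ hφ.1,
    hP.apply_const_mul _ _ hpot.1, hP.apply_potential hφ hk'.measurable hki']
  ring

end IsTransitionSemigroup

end Potential

/-! ### Powers of the generator -/

section Iterates

variable {E : Type*} [MeasurableSpace E]

theorem mem_iterDomain_iff {P : ℝ≥0 → (E → ℝ) → E → ℝ} {φ : E → ℝ} (N : ℕ) :
    φ ∈ iterDomain P N ↔
      φ ∈ strongSpace P ∧ ∀ j < N, (generator P)^[j] φ ∈ generatorDomain P := by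
  induction N with
  | zero => simp [iterDomain]
  | succ N ih =>
    simp only [iterDomain, Set.mem_ofPred_eq, ih, and_assoc, Nat.lt_succ_iff_lt_or_eq]
    refine and_congr_right fun _ => ⟨fun h j hj => ?_, fun h => ⟨fun j hj => h j (Or.inl hj),
      h N (Or.inr rfl)⟩⟩
    rcases hj with hj | rfl
    · exact h.1 j hj
    · exact h.2

theorem iterDomain_antitone {P : ℝ≥0 → (E → ℝ) → E → ℝ} {M N : ℕ} (hMN : M ≤ N) {φ : E → ℝ}
    (h : φ ∈ iterDomain P N) : φ ∈ iterDomain P M := by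
  rw [mem_iterDomain_iff] at *
  exact ⟨h.1, fun j hj => h.2 j (hj.trans_le hMN)⟩

theorem hasGenerator_iterate {P : ℝ≥0 → (E → ℝ) → E → ℝ} {N : ℕ} {φ : E → ℝ}
    (h : φ ∈ iterDomain P N) {j : ℕ} (hj : j < N) :
    (generator P)^[j] φ ∈ boundedFunctions E ∧
      HasGenerator P ((generator P)^[j] φ) ((generator P)^[j + 1] φ) := by
  have hd := ((mem_iterDomain_iff N).1 h).2 j hj
  rw [Function.iterate_succ_apply']
  exact ⟨hd.1, hasGenerator_of_mem_generatorDomain hd⟩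

/-- The powers of the generator on `c ∫₀^∞ P_u φ k(u) du`. -/
theorem IsTransitionSemigroup.iterate_generator_potential {κ : ℝ≥0 → Kernel E E}
    {P : ℝ≥0 → (E → ℝ) → E → ℝ} (hP : IsTransitionSemigroup κ P) {r : ℕ} {φ : E → ℝ}
    (hφ : φ ∈ iterDomain P (r - 1)) {k : ℝ → ℝ} (hk : ContDiff ℝ r k)
    (hki : ∀ j ≤ r, IntegrableOn (iteratedDeriv j k) (Set.Ioi 0)) (c : ℝ) :
    (fun x => c * potential P φ k x) ∈ iterDomain P r ∧
    ∀ j ≤ r, (generator P)^[j] (fun x => c * potential P φ k x) = fun x =>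
      c * ((-1) ^ j * potential P φ (iteratedDeriv j k) x +
        ∑ i ∈ Finset.range j, -((-1) ^ i * iteratedDeriv i k 0) *
          (generator P)^[j - 1 - i] φ x) := by
  have hs : φ ∈ strongSpace P := ((mem_iterDomain_iff _).1 hφ).1
  have hcont : ∀ j ≤ r, Continuous (iteratedDeriv j k) := fun j hj =>
    hk.continuous_iteratedDeriv j (by exact_mod_cast hj)
  have hstep : ∀ j < r,
      (fun x => c * ((-1) ^ j * potential P φ (iteratedDeriv j k) x +
        ∑ i ∈ Finset.range j, -((-1) ^ i * iteratedDeriv i k 0) *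
          (generator P)^[j - 1 - i] φ x)) ∈ boundedFunctions E ∧
      HasGenerator P (fun x => c * ((-1) ^ j * potential P φ (iteratedDeriv j k) x +
        ∑ i ∈ Finset.range j, -((-1) ^ i * iteratedDeriv i k 0) *
          (generator P)^[j - 1 - i] φ x))
        fun x => c * ((-1) ^ (j + 1) * potential P φ (iteratedDeriv (j + 1) k) x +
        ∑ i ∈ Finset.range (j + 1), -((-1) ^ i * iteratedDeriv i k 0) *
          (generator P)^[j + 1 - 1 - i] φ x) := by
    intro j hj
    have hderiv : ∀ u, HasDerivAt (iteratedDeriv j k) (iteratedDeriv (j + 1) k u) u := by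
      intro u
      rw [iteratedDeriv_succ]
      exact (hk.differentiable_iteratedDeriv j (by exact_mod_cast hj) u).hasDerivAt
    have hpb := hP.potential_mem hs (hcont j hj.le).measurable (hki j hj.le)
    have hpg := hP.hasGenerator_potential hs hderiv (hcont (j + 1) hj) (hki j hj.le)
      (hki (j + 1) hj)
    -- As `j < r`, the powers of the generator on `φ` in the sum have order at most `r - 2`, so one
    -- more application is allowed by `φ ∈ D(𝓛^{r-1})`.
    have hlt : ∀ i ∈ Finset.range j, j - 1 - i < r - 1 ∧ j - 1 - i + 1 = j - i := by
      intro i hi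
      rw [Finset.mem_range] at hi
      omega
    obtain ⟨hsb, hsg⟩ := HasGenerator.sum hP (Finset.range j)
      (c := fun i => -((-1) ^ i * iteratedDeriv i k 0))
      (φ := fun i => (generator P)^[j - 1 - i] φ) (v := fun i => (generator P)^[j - i] φ)
      (fun i hi => (hasGenerator_iterate hφ (hlt i hi).1).1)
      (fun i hi => by
        have := (hasGenerator_iterate hφ (hlt i hi).1).2
        rwa [(hlt i hi).2] at this)
    have hpb' := boundedFunctions_const_mul ((-1) ^ j) hpb
    refine ⟨boundedFunctions_const_mul c (boundedFunctions_add hpb' hsb), ?_⟩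
    have hfin := ((hpg.const_mul hP ((-1) ^ j) hpb).add hP hpb' hsb hsg).const_mul hP c
      (boundedFunctions_add hpb' hsb)
    convert hfin using 2 with x
    -- The new summand `i = j`, with zeroth power of the generator, is the boundary term created by
    -- the potential; the others come from raising the old powers by one.
    rw [Finset.sum_range_succ]
    simp only [Nat.add_sub_cancel, Nat.sub_self, Function.iterate_zero, id_eq]
    ring
  have hform : ∀ j ≤ r, (generator P)^[j] (fun x => c * potential P φ k x) = fun x =>
      c * ((-1) ^ j * potential P φ (iteratedDeriv j k) x +
        ∑ i ∈ Finset.range j, -((-1) ^ i * iteratedDeriv i k 0) *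
          (generator P)^[j - 1 - i] φ x) := by
    intro j
    induction j with
    | zero => simp
    | succ j ih =>
      intro hj
      rw [Function.iterate_succ_apply', ih (by omega)]
      exact (hstep j hj).2.generator_eq
  refine ⟨(mem_iterDomain_iff r).2 ⟨?_, fun j hj => ?_⟩, hform⟩
  · refine hP.strongSpace_const_mul c ?_
    exact hP.potential_mem_strongSpace hs hk.continuous.measurable
      (by simpa using hki 0 (Nat.zero_le r))
  · rw [hform j hj.le]
    exact ⟨(hstep j hj).1, _, (hstep j hj).2⟩

end Iterates

/-! ### Transfer of domains through the intertwining kernel -/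

section Intertwining

variable {E F : Type*} [MeasurableSpace E] [MeasureSpace F] {Λ : E → F → ℝ}

theorem IsDensityKernel.integrable (hΛ : IsDensityKernel Λ) (z : E) :
    Integrable (Λ z) ∧ ∫ x, Λ z x = 1 := by
  have hm : Measurable (Λ z) := hΛ.1.of_uncurry_left
  have hi : Integrable (Λ z) := by
    refine ⟨hm.aestronglyMeasurable, ?_⟩
    rw [hasFiniteIntegral_iff_ofReal (ae_of_all _ (hΛ.2.1 z)), hΛ.2.2 z]
    exact ENNReal.one_lt_top
  refine ⟨hi, ?_⟩
  rw [integral_eq_lintegral_of_nonneg_ae (ae_of_all _ (hΛ.2.1 z)) hm.aestronglyMeasurable,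
    hΛ.2.2 z, ENNReal.toReal_one]

theorem IsDensityKernel.integrable_mul (hΛ : IsDensityKernel Λ) {φ : F → ℝ}
    (hφ : φ ∈ boundedFunctions F) (z : E) : Integrable fun x => Λ z x * φ x := by
  obtain ⟨hφm, C, hC⟩ := hφ
  exact (hΛ.integrable z).1.mul_bdd hφm.aestronglyMeasurable (ae_of_all _ hC)

theorem IsDensityKernel.abs_kernelOp_le (hΛ : IsDensityKernel Λ) {φ : F → ℝ} {C : ℝ}
    (hC : ∀ x, |φ x| ≤ C) (z : E) : |kernelOp Λ φ z| ≤ C := by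
  obtain ⟨hi, h1⟩ := hΛ.integrable z
  calc |kernelOp Λ φ z| = ‖∫ x, Λ z x * φ x‖ := rfl
    _ ≤ ∫ x, Λ z x * C := by
        refine norm_integral_le_of_norm_le (hi.mul_const C) (ae_of_all _ fun x => ?_)
        rw [norm_mul, Real.norm_of_nonneg (hΛ.2.1 z x)]
        exact mul_le_mul_of_nonneg_left (hC x) (hΛ.2.1 z x)
    _ = C := by rw [integral_mul_const, h1, one_mul]

theorem IsDensityKernel.kernelOp_mem [SFinite (volume : Measure F)] (hΛ : IsDensityKernel Λ)
    {φ : F → ℝ} (hφ : φ ∈ boundedFunctions F) : kernelOp Λ φ ∈ boundedFunctions E := by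
  obtain ⟨hφm, C, hC⟩ := hφ
  refine ⟨?_, C, hΛ.abs_kernelOp_le hC⟩
  have : Measurable fun z : E × F => Λ z.1 z.2 * φ z.2 := hΛ.1.mul (hφm.comp measurable_snd)
  exact this.stronglyMeasurable.integral_prod_right'.measurable

theorem IsDensityKernel.kernelOp_sub (hΛ : IsDensityKernel Λ) {φ ψ : F → ℝ}
    (hφ : φ ∈ boundedFunctions F) (hψ : ψ ∈ boundedFunctions F) (z : E) :
    kernelOp Λ (fun x => φ x - ψ x) z = kernelOp Λ φ z - kernelOp Λ ψ z := by
  simp only [kernelOp, mul_sub]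
  exact integral_sub (hΛ.integrable_mul hφ z) (hΛ.integrable_mul hψ z)

theorem kernelOp_mul_const {G : Type*} {Λ : G → F → ℝ} (φ : F → ℝ) (c : ℝ) (z : G) :
    kernelOp Λ (fun x => φ x * c) z = kernelOp Λ φ z * c := by
  simp only [kernelOp, ← mul_assoc]
  exact integral_mul_const _ _

theorem IsDensityKernel.tendstoUniformly (hΛ : IsDensityKernel Λ) {ι : Type*} {l : Filter ι}
    {G : ι → F → ℝ} {w : F → ℝ} (hG : ∀ i, G i ∈ boundedFunctions F)
    (hw : w ∈ boundedFunctions F) (h : TendstoUniformly G w l) :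
    TendstoUniformly (fun i => kernelOp Λ (G i)) (kernelOp Λ w) l := by
  refine Metric.tendstoUniformly_iff.2 fun ε hε => ?_
  filter_upwards [Metric.tendstoUniformly_iff.1 h (ε / 2) (half_pos hε)] with i hi z
  rw [Real.dist_eq, ← hΛ.kernelOp_sub hw (hG i)]
  exact (hΛ.abs_kernelOp_le (fun x => (hi x).le) z).trans_lt (half_lt_self hε)

variable {κ : ℝ≥0 → Kernel F F} {PX : ℝ≥0 → (F → ℝ) → F → ℝ} {PU : ℝ≥0 → (E → ℝ) → E → ℝ}

/-- For `t > 0` the intertwining turns the difference quotient of `Lφ` into `L` of that of `φ`, and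
the contraction `L` preserves uniform convergence. -/
theorem IsIntertwining.hasGenerator (hΛ : IsIntertwining PX PU Λ)
    (hPX : IsTransitionSemigroup κ PX) {φ w : F → ℝ} (hφ : φ ∈ boundedFunctions F)
    (h : HasGenerator PX φ w) : HasGenerator PU (kernelOp Λ φ) (kernelOp Λ w) := by
  have hb := fun t => boundedFunctions_sub (hPX.apply_mem t hφ) hφ
  have hu := hΛ.1.tendstoUniformly (G := fun (t : ℝ≥0) x => (PX t φ x - φ x) / (t : ℝ))
    (fun t => by simpa only [div_eq_inv_mul] using boundedFunctions_const_mul (t : ℝ)⁻¹ (hb t))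
    (h.mem_boundedFunctions hPX hφ) h
  refine Metric.tendstoUniformly_iff.2 fun ε hε => ?_
  filter_upwards [Metric.tendstoUniformly_iff.1 hu ε hε, self_mem_nhdsWithin] with t ht hpos z
  refine lt_of_eq_of_lt ?_ (ht z)
  simp only [div_eq_mul_inv]
  rw [kernelOp_mul_const, hΛ.1.kernelOp_sub (hPX.apply_mem t hφ) hφ, hΛ.2 t hpos φ hφ]

theorem IsIntertwining.strongSpace [SFinite (volume : Measure F)] (hΛ : IsIntertwining PX PU Λ)
    (hPX : IsTransitionSemigroup κ PX) {φ : F → ℝ} (hφ : φ ∈ strongSpace PX) :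
    kernelOp Λ φ ∈ strongSpace PU := by
  refine ⟨hΛ.1.kernelOp_mem hφ.1, ?_⟩
  have hu := hΛ.1.tendstoUniformly (fun t => hPX.apply_mem t hφ.1) hφ.1 hφ.2
  refine Metric.tendstoUniformly_iff.2 fun ε hε => ?_
  filter_upwards [Metric.tendstoUniformly_iff.1 hu ε hε, self_mem_nhdsWithin] with t ht hpos z
  rw [hΛ.2 t hpos φ hφ.1]
  exact ht z

theorem IsIntertwining.iterDomain [SFinite (volume : Measure F)] (hΛ : IsIntertwining PX PU Λ)
    (hPX : IsTransitionSemigroup κ PX) {N : ℕ} {φ : F → ℝ} (hφ : φ ∈ iterDomain PX N) :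
    kernelOp Λ φ ∈ iterDomain PU N := by
  have hform : ∀ j ≤ N, (generator PU)^[j] (kernelOp Λ φ) =
      kernelOp Λ ((generator PX)^[j] φ) := by
    intro j
    induction j with
    | zero => simp
    | succ j ih =>
      intro hj
      obtain ⟨hb, hg⟩ := hasGenerator_iterate hφ (Nat.lt_of_succ_le hj)
      rw [Function.iterate_succ_apply', ih (by omega)]
      exact (hΛ.hasGenerator hPX hb hg).generator_eq
  refine (mem_iterDomain_iff N).2
    ⟨hΛ.strongSpace hPX ((mem_iterDomain_iff N).1 hφ).1, fun j hj => ?_⟩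
  obtain ⟨hb, hg⟩ := hasGenerator_iterate hφ hj
  rw [hform j hj.le]
  exact ⟨hΛ.1.kernelOp_mem hb, _, hΛ.hasGenerator hPX hb hg⟩

end Intertwining

/-! ### Differentiation in time under the integral -/

section TimeDerivatives

/-- The half-line `t > 0` is open, so an identity valid there holds near each `t` and may be
differentiated; values at `t ≤ 0` play no role. -/
theorem iteratedDeriv_eq_of_hasDerivAt {f : ℝ → ℝ} {G : ℕ → ℝ → ℝ} {N : ℕ}
    (h0 : ∀ t > 0, f t = G 0 t) (h : ∀ i < N, ∀ t > 0, HasDerivAt (G i) (G (i + 1) t) t) :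
    ∀ i ≤ N, ∀ t > 0, iteratedDeriv i f t = G i t := by
  intro i
  induction i with
  | zero => simpa using h0
  | succ i ih =>
    intro hi t ht
    have he : iteratedDeriv i f =ᶠ[𝓝 t] G i :=
      (eventually_gt_nhds ht).mono fun s hs => ih (by omega) s hs
    rw [iteratedDeriv_succ, he.deriv_eq]
    exact (h i hi t ht).deriv

theorem differentiableAt_iteratedDeriv_of_hasDerivAt {f : ℝ → ℝ} {G : ℕ → ℝ → ℝ} {N : ℕ}
    (h0 : ∀ t > 0, f t = G 0 t) (h : ∀ i < N, ∀ t > 0, HasDerivAt (G i) (G (i + 1) t) t)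
    {i : ℕ} (hi : i < N) {t : ℝ} (ht : 0 < t) : DifferentiableAt ℝ (iteratedDeriv i f) t := by
  have he : iteratedDeriv i f =ᶠ[𝓝 t] G i :=
    (eventually_gt_nhds ht).mono fun s hs => iteratedDeriv_eq_of_hasDerivAt h0 h i hi.le s hs
  exact (h i hi t ht).differentiableAt.congr_of_eventuallyEq he

variable {K : ℝ → ℝ → ℝ} {K' : ℝ → ℝ} {t : ℝ}

/-- A derivative in `L¹` of integrable functions is integrable. -/
theorem integrable_of_L1_derivative (ht : 0 < t) (hK : ∀ s > 0, Integrable (K s))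
    (hd : ∀ u, HasDerivAt (fun s => K s u) (K' u) t)
    (hL : Tendsto (fun s => ∫⁻ u, ‖(K s u - K t u) / (s - t) - K' u‖ₑ) (𝓝[≠] t) (𝓝 0)) :
    Integrable K' := by
  have hq : ∀ s > 0, Integrable fun u => (K s u - K t u) / (s - t) := fun s hs =>
    ((hK s hs).sub (hK t ht)).div_const _
  have hm : AEStronglyMeasurable K' volume := by
    -- A sequence of times makes `K'` a countable pointwise limit of measurable quotients.
    have hseq : Tendsto (fun n : ℕ => t + 1 / ((n : ℝ) + 1)) atTop (𝓝[≠] t) := by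
      refine tendsto_nhdsWithin_iff.2 ⟨?_, Eventually.of_forall fun n => ?_⟩
      · simpa using tendsto_const_nhds.add (tendsto_one_div_add_atTop_nhds_zero_nat (𝕜 := ℝ))
      · have : (0 : ℝ) < 1 / ((n : ℝ) + 1) := by positivity
        simpa using this.ne'
    refine aestronglyMeasurable_of_tendsto_ae atTop
      (f := fun (n : ℕ) u => (K (t + 1 / ((n : ℝ) + 1)) u - K t u) / (t + 1 / ((n : ℝ) + 1) - t))
      (fun n => (hq _ (by positivity)).aestronglyMeasurable) (ae_of_all _ fun u => ?_)
    have hu := (hasDerivAt_iff_tendsto_slope.1 (hd u)).comp hseq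
    simpa only [Function.comp_def, slope_def_field] using hu
  have hpos : ∀ᶠ s in 𝓝[≠] t, 0 < s := nhdsWithin_le_nhds (eventually_gt_nhds ht)
  obtain ⟨s, hs1, hs⟩ := ((hL.eventually_lt_const one_pos).and hpos).exists
  have hi : Integrable fun u => (K s u - K t u) / (s - t) - K' u :=
    ⟨(hq s hs).aestronglyMeasurable.sub hm, hs1.trans ENNReal.one_lt_top⟩
  refine ((hq s hs).sub hi).congr (ae_of_all _ fun u => ?_)
  simp

/-- Multiplication by `F` costs at most the factor `C` in `L¹`, so the quotients still converge in
`L¹` and their integrals converge, without any dominating function. -/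
theorem hasDerivAt_setIntegral_of_L1 {F : ℝ → ℝ} {C : ℝ} {S : Set ℝ} (hF : Measurable F)
    (hC : ∀ u, |F u| ≤ C) (ht : 0 < t) (hK : ∀ s > 0, Integrable (K s)) (hK' : Integrable K')
    (hL : Tendsto (fun s => ∫⁻ u, ‖(K s u - K t u) / (s - t) - K' u‖ₑ) (𝓝[≠] t) (𝓝 0)) :
    HasDerivAt (fun s => ∫ u in S, F u * K s u) (∫ u in S, F u * K' u) t := by
  have hmul : ∀ {k : ℝ → ℝ}, Integrable k → IntegrableOn (fun u => F u * k u) S := fun hk =>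
    hk.integrableOn.bdd_mul (c := C) hF.aestronglyMeasurable (ae_of_all _ hC)
  have hq : ∀ s > 0, Integrable fun u => (K s u - K t u) / (s - t) := fun s hs =>
    ((hK s hs).sub (hK t ht)).div_const _
  have hpos : ∀ᶠ s in 𝓝[≠] t, 0 < s := nhdsWithin_le_nhds (eventually_gt_nhds ht)
  rw [hasDerivAt_iff_tendsto_slope]
  have hlim : Tendsto (fun s => ∫ u in S, F u * ((K s u - K t u) / (s - t))) (𝓝[≠] t)
      (𝓝 (∫ u in S, F u * K' u)) := by
    refine tendsto_integral_of_L1 _ (hmul hK').aestronglyMeasurable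
      (hpos.mono fun s hs => hmul (hq s hs)) ?_
    have hC' := ENNReal.Tendsto.const_mul (a := ENNReal.ofReal C) hL (Or.inr ENNReal.ofReal_ne_top)
    rw [mul_zero] at hC'
    refine tendsto_of_tendsto_of_tendsto_of_le_of_le tendsto_const_nhds hC' (fun _ => zero_le)
      fun s => ?_
    calc _ ≤ ∫⁻ u, ‖F u * ((K s u - K t u) / (s - t)) - F u * K' u‖ₑ :=
          setLIntegral_le_lintegral _ _
      _ ≤ ∫⁻ u, ENNReal.ofReal C * ‖(K s u - K t u) / (s - t) - K' u‖ₑ := by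
          refine lintegral_mono fun u => ?_
          rw [← mul_sub, enorm_mul]
          gcongr
          rw [Real.enorm_eq_ofReal_abs]
          exact ENNReal.ofReal_le_ofReal (hC u)
      _ = _ := lintegral_const_mul' _ _ ENNReal.ofReal_ne_top
  refine hlim.congr' (hpos.mono fun s hs => ?_)
  rw [slope_def_field, ← integral_sub (hmul (hK s hs)) (hmul (hK t ht)), ← integral_div]
  refine integral_congr_ae (ae_of_all _ fun u => ?_)
  simp only
  ring

end TimeDerivatives

/-! ### The even part of the density -/

section EvenPart

variable {Ω : Type*} [MeasurableSpace Ω] {μ : Measure Ω} {Y : ℝ≥0 → Ω → ℝ} {p : ℝ → ℝ → ℝ}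
  {m q r : ℕ} {α : ℕ → ℝ → ℝ} {β : ℕ → ℕ → ℝ → ℝ}

theorem nnabs_eq_toNNReal_abs (u : ℝ) : Real.nnabs u = |u|.toNNReal := NNReal.eq (by simp)

theorem measurable_nnabs : Measurable fun u : ℝ => Real.nnabs u := by
  simp only [nnabs_eq_toNNReal_abs]
  exact measurable_real_toNNReal.comp measurable_abs

theorem mixedDeriv_zero_left (j : ℕ) (F : ℝ → ℝ → ℝ) (t : ℝ) :
    mixedDeriv 0 j F t = iteratedDeriv j (F t) := by
  funext u
  simp [mixedDeriv]

theorem hasDerivAt_mixedDeriv {F : ℝ → ℝ → ℝ} {i j : ℕ} {t u : ℝ}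
    (h : DifferentiableAt ℝ (fun s => mixedDeriv i j F s u) t) :
    HasDerivAt (fun s => mixedDeriv i j F s u) (mixedDeriv (i + 1) j F t u) t := by
  have e : mixedDeriv (i + 1) j F t u = deriv (fun s => mixedDeriv i j F s u) t := by
    simp only [mixedDeriv, iteratedDeriv_succ]
  rw [e]
  exact h.hasDerivAt

namespace TimeProcess

theorem contDiff_evenPart (hY : TimeProcess μ Y p m q r α β) {t : ℝ} (ht : 0 < t) :
    ContDiff ℝ r (evenPart p t) :=
  ((hY.contDiff t ht).add ((hY.contDiff t ht).comp contDiff_neg)).div_const 2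

theorem iteratedDeriv_evenPart (hY : TimeProcess μ Y p m q r α β) {j : ℕ} (hj : j ≤ r) {t : ℝ}
    (ht : 0 < t) (u : ℝ) : iteratedDeriv j (evenPart p t) u =
      (iteratedDeriv j (p t) u + (-1) ^ j * iteratedDeriv j (p t) (-u)) / 2 := by
  have hc : ContDiff ℝ j (p t) := (hY.contDiff t ht).of_le (by exact_mod_cast hj)
  have hc' : ContDiff ℝ j fun v => p t (-v) := hc.comp contDiff_neg
  have e : evenPart p t = fun v => (2⁻¹ : ℝ) * (p t v + p t (-v)) := by
    funext v
    simp only [evenPart]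
    ring
  rw [e, iteratedDeriv_const_mul _ (hc.add hc').contDiffAt,
    iteratedDeriv_fun_add hc.contDiffAt hc'.contDiffAt, iteratedDeriv_comp_neg]
  simp only [smul_eq_mul]
  ring

theorem hasDerivAt_evenPart_of_density (hY : TimeProcess μ Y p m q r α β) {i j : ℕ} (hi : i < q)
    (hj : j ≤ r) {t : ℝ} (ht : 0 < t) (u : ℝ) :
    HasDerivAt (fun s => (mixedDeriv i j p s u + (-1) ^ j * mixedDeriv i j p s (-u)) / 2)
      ((mixedDeriv (i + 1) j p t u + (-1) ^ j * mixedDeriv (i + 1) j p t (-u)) / 2) t :=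
  ((hasDerivAt_mixedDeriv (hY.differentiable i hi j hj t ht u)).add
    ((hasDerivAt_mixedDeriv (hY.differentiable i hi j hj t ht (-u))).const_mul _)).div_const 2

theorem mixedDeriv_evenPart (hY : TimeProcess μ Y p m q r α β) {i j : ℕ} (hi : i ≤ q)
    (hj : j ≤ r) {t : ℝ} (ht : 0 < t) (u : ℝ) : mixedDeriv i j (evenPart p) t u =
      (mixedDeriv i j p t u + (-1) ^ j * mixedDeriv i j p t (-u)) / 2 := by
  refine iteratedDeriv_eq_of_hasDerivAt (N := q)
    (G := fun i s => (mixedDeriv i j p s u + (-1) ^ j * mixedDeriv i j p s (-u)) / 2)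
    (fun s hs => ?_) (fun i hi s hs => hY.hasDerivAt_evenPart_of_density hi hj hs u) i hi t ht
  simp only [mixedDeriv_zero_left]
  exact hY.iteratedDeriv_evenPart hj hs u

theorem hasDerivAt_mixedDeriv_evenPart (hY : TimeProcess μ Y p m q r α β) {i j : ℕ}
    (hij : (i < m ∧ j = 0) ∨ (i < q ∧ j ≤ r)) {t : ℝ} (ht : 0 < t) (u : ℝ) :
    HasDerivAt (fun s => mixedDeriv i j (evenPart p) s u)
      (mixedDeriv (i + 1) j (evenPart p) t u) t := by
  refine hasDerivAt_mixedDeriv ?_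
  rcases hij with ⟨hi, rfl⟩ | ⟨hi, hj⟩
  · exact hY.differentiable_even i hi t ht u
  · refine (hY.hasDerivAt_evenPart_of_density hi hj ht u).differentiableAt.congr_of_eventuallyEq ?_
    exact (eventually_gt_nhds ht).mono fun s hs => hY.mixedDeriv_evenPart hi.le hj hs u

theorem integrable_mixedDeriv_evenPart (hY : TimeProcess μ Y p m q r α β) {i j : ℕ}
    (hij : (i ≤ m ∧ j = 0) ∨ (i ≤ q ∧ j ≤ r)) {t : ℝ} (ht : 0 < t) :
    Integrable (mixedDeriv i j (evenPart p) t) := by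
  have hdens : ∀ {i j}, i ≤ q → j ≤ r → ∀ {t : ℝ}, 0 < t →
      Integrable (mixedDeriv i j (evenPart p) t) := by
    intro i j hi hj t ht
    have hp := hY.integrable i hi j hj t ht
    rw [funext (hY.mixedDeriv_evenPart hi hj ht)]
    exact (hp.add (hp.comp_neg.const_mul _)).div_const 2
  rcases hij with ⟨hi, rfl⟩ | ⟨hi, hj⟩
  -- Here `i` may exceed `q`, where integrability is not assumed; it is inherited from order to
  -- order through the `L¹` derivatives.
  · induction i generalizing t with
    | zero => exact hdens (Nat.zero_le q) (Nat.zero_le r) ht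
    | succ i ih =>
      exact integrable_of_L1_derivative ht (fun s hs => ih hs (by omega))
        (hY.hasDerivAt_mixedDeriv_evenPart (Or.inl ⟨hi, rfl⟩) ht)
        (hY.deriv_L1 i 0 (Or.inl ⟨hi, rfl⟩) t ht)
  · exact hdens hi hj ht

theorem hasDerivAt_integral_mixedDeriv (hY : TimeProcess μ Y p m q r α β) {i j : ℕ}
    (hij : (i < m ∧ j = 0) ∨ (i < q ∧ j ≤ r)) {F : ℝ → ℝ} {C : ℝ} (hF : Measurable F)
    (hC : ∀ u, |F u| ≤ C) (S : Set ℝ) {t : ℝ} (ht : 0 < t) :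
    HasDerivAt (fun s => ∫ u in S, F u * mixedDeriv i j (evenPart p) s u)
      (∫ u in S, F u * mixedDeriv (i + 1) j (evenPart p) t u) t :=
  hasDerivAt_setIntegral_of_L1 hF hC ht
    (fun _ hs => hY.integrable_mixedDeriv_evenPart (hij.imp (.imp_left le_of_lt)
      (.imp_left le_of_lt)) hs)
    (hY.integrable_mixedDeriv_evenPart hij ht) (hY.deriv_L1 i j hij t ht)

/-- The even part of the density is the weight with which `|Y_t|` averages the semigroup. -/
theorem iteratedMean_eq_potential [IsProbabilityMeasure μ] {E : Type*} [TopologicalSpace E]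
    [TopologicalSpace.PseudoMetrizableSpace E] [MeasurableSpace E] [BorelSpace E]
    (hY : TimeProcess μ Y p m q r α β) {U : E → ℝ≥0 → Ω → E} (hU : IsDiffusion μ U)
    (hUY : ∀ x, IndepFun (fun ω t => U x t ω) (fun ω t => Y t ω) μ) {g : E → ℝ}
    (hg : g ∈ strongSpace (semigroup μ U)) {t : ℝ} (ht : 0 < t) :
    iteratedMean μ U Y g t = fun x => 2 * potential (semigroup μ U) g (evenPart p t) x := by
  obtain ⟨κ, hP⟩ := hU.exists_isTransitionSemigroup
  funext x
  obtain ⟨C, hC⟩ := hg.1.2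
  have hYm : Measurable (Y t.toNNReal) := hY.measurable _
  have hT : Measurable fun y : ℝ≥0 → ℝ => Real.nnabs (y t.toNNReal) :=
    measurable_nnabs.comp (measurable_pi_apply _)
  set F : ℝ → ℝ := fun u => semigroup μ U u.toNNReal g x with hF
  have hFc : Continuous F := hP.continuous_apply_toNNReal hg x
  have hFC : ∀ u, |F u| ≤ C := fun u => hP.abs_apply_le _ hg.1.1 hC x
  have hpi : Integrable (p t) := by
    simpa [mixedDeriv_zero_left] using hY.integrable 0 (Nat.zero_le q) 0 (Nat.zero_le r) t ht
  have hpm : Measurable (p t) := (hY.contDiff t ht).continuous.measurable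
  have h1 : iteratedMean μ U Y g t x = ∫ ω, F |Y t.toNNReal ω| ∂μ := by
    have h := integral_comp_indep_time (μ := μ) (X := U x)
      (T := fun ω => Real.nnabs (Y t.toNNReal ω)) (hU.1 x) (hU.2.2.1 x)
      (measurable_nnabs.comp hYm) ((hUY x).comp measurable_id hT) hg.1
    refine h.trans (integral_congr_ae (ae_of_all _ fun ω => ?_))
    simp only [hF, semigroup, nnabs_eq_toNNReal_abs]
  have h2 : ∫ ω, F |Y t.toNNReal ω| ∂μ = ∫ u, p t u * F |u| := by
    have hm : Measurable fun u : ℝ => F |u| := hFc.measurable.comp measurable_abs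
    rw [← integral_map (f := fun u => F |u|) hYm.aemeasurable hm.aestronglyMeasurable,
      hY.density t ht,
      integral_withDensity_eq_integral_toReal_smul hpm.ennreal_ofReal (by simp)]
    simp only [ENNReal.toReal_ofReal (hY.nonneg t ht _), smul_eq_mul]
  have hint : Integrable fun u => p t u * F |u| :=
    hpi.mul_bdd (c := C) (hFc.comp continuous_abs).aestronglyMeasurable
      (ae_of_all _ fun u => hFC _)
  have h3 : ∫ u, p t (-u) * F |u| = ∫ u, p t u * F |u| := by
    rw [← integral_neg_eq_self (fun u => p t u * F |u|)]
    simp only [abs_neg]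
  have hint' : Integrable fun u => p t (-u) * F |u| := by
    simpa only [abs_neg] using hint.comp_neg
  -- The factor `F |u|` is even, so the density may be replaced by its even part. The whole
  -- integrand is then a function of `|u|`, and folding the line at `0` gives the factor `2`.
  have h4 : ∫ u, p t u * F |u| = ∫ u, (fun v => F v * evenPart p t v) |u| := by
    have e : ∀ u, (fun v => F v * evenPart p t v) |u| =
        (p t u * F |u| + p t (-u) * F |u|) / 2 := by
      intro u
      simp only [evenPart]
      rcases abs_choice u with h | h <;> rw [h]
      · ring
      · rw [neg_neg]
        ring
    simp_rw [e]
    rw [integral_div, integral_add hint hint', h3]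
    ring
  rw [h1, h2, h4, integral_comp_abs (f := fun v => F v * evenPart p t v)]
  rfl

end TimeProcess

end EvenPart

/-- Used to match the boundary term, indexed by even orders, with the sum over all orders from
integration by parts. For `j = 0` both sums are empty despite the truncated `j - 1`. -/
theorem sum_range_eq_sum_even {j : ℕ} {a : ℕ → ℝ} (ha : ∀ l, Odd l → a l = 0) :
    ∑ k ∈ (Finset.range j).filter (fun k => 2 * k ≤ j - 1), a (2 * k) =
      ∑ l ∈ Finset.range j, a l := by
  refine Finset.sum_of_injOn (fun k => 2 * k) (fun k _ l _ h => ?_) (fun k hk => ?_)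
    (fun l hl hl' => ha l ?_) fun k _ => rfl
  · simpa using h
  · simp only [Finset.coe_filter, Finset.mem_range, Set.mem_ofPred_eq, Finset.coe_range,
      Set.mem_Iio] at *
    omega
  · by_contra hodd
    obtain ⟨k, rfl⟩ := even_iff_exists_two_mul.1 (Nat.not_odd_iff_even.1 hodd)
    refine hl' ⟨k, ?_, rfl⟩
    simp only [Finset.coe_filter, Finset.mem_range, Set.mem_ofPred_eq] at *
    omega

end IteratedProcess

end

/-! ### The equation for the iterated process -/

theorem mainTheorem7 {Ω : Type*} [MeasurableSpace Ω] (μ : Measure Ω) [IsProbabilityMeasure μ]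
    (d n : ℕ)
    (X : EuclideanSpace ℝ (Fin d) → ℝ≥0 → Ω → EuclideanSpace ℝ (Fin d))
    (U : EuclideanSpace ℝ (Fin n) → ℝ≥0 → Ω → EuclideanSpace ℝ (Fin n))
    (hX : IsDiffusion μ X) (hU : IsDiffusion μ U)
    (Y : ℝ≥0 → Ω → ℝ) (p : ℝ → ℝ → ℝ) (m q r : ℕ) (hr : 1 ≤ r)
    (α : ℕ → ℝ → ℝ) (β : ℕ → ℕ → ℝ → ℝ)
    (hY : TimeProcess μ Y p m q r α β)
    (hXY : ∀ x, IndepFun (fun ω t => X x t ω) (fun ω t => Y t ω) μ)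
    (hUY : ∀ x, IndepFun (fun ω t => U x t ω) (fun ω t => Y t ω) μ)
    (Λ : EuclideanSpace ℝ (Fin n) → EuclideanSpace ℝ (Fin d) → ℝ)
    (hΛ : IsIntertwining (semigroup μ X) (semigroup μ U) Λ)
    (f : EuclideanSpace ℝ (Fin d) → ℝ) (hf : f ∈ iterDomain (semigroup μ X) (r - 1))
    (g : EuclideanSpace ℝ (Fin n) → ℝ) (hg : g = kernelOp Λ f)
    (h : ℝ → EuclideanSpace ℝ (Fin n) → ℝ) (hh : h = iteratedMean μ U Y g) :
    -- domains: `h(t, ·) ∈ D(𝓛_U^{r-1})`, and the powers `𝓛_U^j h`, `j ≤ r`, of the equation exist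
    (∀ t ≥ 0, h t ∈ iterDomain (semigroup μ U) (r - 1)) ∧
    (∀ t > 0, h t ∈ iterDomain (semigroup μ U) r) ∧
    -- the time derivatives in the equation exist
    (∀ x, ∀ k < m, ∀ t > 0, DifferentiableAt ℝ (iteratedDeriv k fun s => h s x) t) ∧
    (∀ x, ∀ i < q, ∀ j ≤ r, ∀ t > 0,
      DifferentiableAt ℝ (iteratedDeriv i fun s => (generator (semigroup μ U))^[j] (h s) x) t) ∧
    -- the equation
    (∀ t > 0, ∀ x,
      ∑ k ∈ Finset.Icc 1 m, α k t * iteratedDeriv k (fun s => h s x) t =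
        ∑ i ∈ Finset.range (q + 1), ∑ j ∈ Finset.Icc 1 r, β i j t * (-1) ^ j *
          iteratedDeriv i (fun s => (generator (semigroup μ U))^[j] (h s) x) t
        + boundaryTerm (generator (semigroup μ U)) p q r β g t x) ∧
    -- the initial condition
    (∀ x, h 0 x = g x) := by
  obtain ⟨κX, hPX⟩ := hX.exists_isTransitionSemigroup
  obtain ⟨κ, hP⟩ := hU.exists_isTransitionSemigroup
  set P := semigroup μ U with hPdef
  have hgdom : g ∈ iterDomain P (r - 1) := hg ▸ hΛ.iterDomain hPX hf
  have hgs : g ∈ strongSpace P := ((mem_iterDomain_iff _).1 hgdom).1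
  obtain ⟨C, hC⟩ := hgs.1.2
  have hpot : ∀ t > 0, h t = fun x => 2 * potential P g (evenPart p t) x := fun t ht => by
    rw [hh]
    exact hY.iteratedMean_eq_potential hU hUY hgs ht
  have hiter := fun (t : ℝ) (ht : 0 < t) =>
    hP.iterate_generator_potential hgdom (hY.contDiff_evenPart (t := t) ht)
      (fun j hj => by
        have := hY.integrable_mixedDeriv_evenPart (i := 0) (Or.inr ⟨Nat.zero_le q, hj⟩) ht
        rw [mixedDeriv_zero_left] at this
        exact this.integrableOn) 2
  have hdom : ∀ t > 0, h t ∈ iterDomain P r := fun t ht => by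
    rw [hpot t ht]
    exact (hiter t ht).1
  have hstart : ∀ x, h 0 x = g x := by
    intro x
    have e : (fun ω => g (U x (Real.nnabs (Y (Real.toNNReal 0) ω)) ω)) =ᵐ[μ] fun _ => g x := by
      filter_upwards [hY.start, hU.2.1 x] with ω h1 h2
      rw [Real.toNNReal_zero, h1, map_zero, h2]
    rw [hh, iteratedMean, integral_congr_ae e]
    simp
  -- The families of time derivatives of `h` and of the powers `𝓛^j h`.
  set F : EuclideanSpace ℝ (Fin n) → ℝ → ℝ := fun x u => P u.toNNReal g x with hF
  have hFm : ∀ x, Measurable (F x) := fun x => (hP.continuous_apply_toNNReal hgs x).measurable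
  have hFC : ∀ x u, |F x u| ≤ C := fun x u => hP.abs_apply_le _ hgs.1.1 hC x
  set J : ℕ → ℕ → EuclideanSpace ℝ (Fin n) → ℝ → ℝ := fun i j x t =>
    ∫ u in Set.Ioi (0 : ℝ), F x u * mixedDeriv i j (evenPart p) t u with hJ
  have hJd : ∀ i j, (i < m ∧ j = 0) ∨ (i < q ∧ j ≤ r) → ∀ x, ∀ t > 0,
      HasDerivAt (J i j x) (J (i + 1) j x t) t := fun i j hij x t ht =>
    hY.hasDerivAt_integral_mixedDeriv hij (hFm x) (hFC x) _ ht
  set S : ℕ → ℕ → EuclideanSpace ℝ (Fin n) → ℝ → ℝ := fun i j x t =>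
    ∑ l ∈ Finset.range j, -((-1) ^ l * mixedDeriv i l (evenPart p) t 0) *
      (generator P)^[j - 1 - l] g x with hS
  have hSd : ∀ i < q, ∀ j ≤ r, ∀ x, ∀ t > 0, HasDerivAt (S i j x) (S (i + 1) j x t) t := by
    intro i hi j hj x t ht
    refine HasDerivAt.fun_sum fun l hl => ?_
    have hl' : l ≤ r := (Finset.mem_range.1 hl).le.trans hj
    exact (((hY.hasDerivAt_mixedDeriv_evenPart (Or.inr ⟨hi, hl'⟩) ht 0).const_mul _).neg).mul_const
      _
  have hh0 : ∀ x, ∀ t > 0, h t x = 2 * J 0 0 x t := by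
    intro x t ht
    simp only [hpot t ht, hJ, potential, hF, mixedDeriv_zero_left, iteratedDeriv_zero]
  have hhd : ∀ x, ∀ k < m, ∀ t > 0,
      HasDerivAt (fun s => 2 * J k 0 x s) (2 * J (k + 1) 0 x t) t := fun x k hk t ht =>
    (hJd k 0 (Or.inl ⟨hk, rfl⟩) x t ht).const_mul 2
  have hg0 : ∀ x, ∀ j ≤ r, ∀ t > 0,
      (generator P)^[j] (h t) x = 2 * ((-1) ^ j * J 0 j x t + S 0 j x t) := by
    intro x j hj t ht
    rw [hpot t ht, (hiter t ht).2 j hj]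
    simp only [hJ, hS, potential, hF, mixedDeriv_zero_left]
  have hgd : ∀ x, ∀ j ≤ r, ∀ i < q, ∀ t > 0,
      HasDerivAt (fun s => 2 * ((-1) ^ j * J i j x s + S i j x s))
        (2 * ((-1) ^ j * J (i + 1) j x t + S (i + 1) j x t)) t := fun x j hj i hi t ht =>
    (((hJd i j (Or.inr ⟨hi, hj⟩) x t ht).const_mul _).add (hSd i hi j hj x t ht)).const_mul 2
  have hhk := fun x => iteratedDeriv_eq_of_hasDerivAt (f := fun s => h s x)
    (G := fun k s => 2 * J k 0 x s) (hh0 x) (hhd x)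
  have hgi := fun x j (hj : j ≤ r) => iteratedDeriv_eq_of_hasDerivAt
    (f := fun s => (generator P)^[j] (h s) x)
    (G := fun i s => 2 * ((-1) ^ j * J i j x s + S i j x s)) (hg0 x j hj) (hgd x j hj)
  refine ⟨fun t ht => ?_, hdom, fun x k hk t ht => ?_, fun x i hi j hj t ht => ?_,
    fun t ht x => ?_, hstart⟩
  -- At `t = 0` there is no averaging: `h 0 = g` has only the order `r - 1` of `g`.
  · rcases ht.eq_or_lt with rfl | ht
    · rwa [show h 0 = g from funext hstart]
    · exact iterDomain_antitone (Nat.sub_le r 1) (hdom t ht)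
  · exact differentiableAt_iteratedDeriv_of_hasDerivAt (G := fun k s => 2 * J k 0 x s) (hh0 x)
      (hhd x) hk ht
  · exact differentiableAt_iteratedDeriv_of_hasDerivAt
      (G := fun i s => 2 * ((-1) ^ j * J i j x s + S i j x s)) (hg0 x j hj) (hgd x j hj) hi ht
  · have hint : ∀ {i j}, (i ≤ m ∧ j = 0) ∨ (i ≤ q ∧ j ≤ r) → ∀ c : ℝ,
        Integrable (fun u => F x u * (c * mixedDeriv i j (evenPart p) t u))
          (volume.restrict (Set.Ioi 0)) := fun hij c =>
      (((hY.integrable_mixedDeriv_evenPart hij ht).const_mul c).integrableOn).bdd_mul (c := C)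
        (hFm x).aestronglyMeasurable (ae_of_all _ (hFC x))
    have hpull : ∀ (c : ℝ) i j, ∫ u in Set.Ioi (0 : ℝ),
        F x u * (c * mixedDeriv i j (evenPart p) t u) = c * J i j x t := by
      intro c i j
      rw [hJ, ← integral_const_mul]
      exact integral_congr_ae (ae_of_all _ fun u => by ring)
    -- This is the equation for the even part, integrated against `P_u g(x)` over the half-line.
    have heq : ∑ k ∈ Finset.Icc 1 m, α k t * J k 0 x t =
        ∑ i ∈ Finset.range (q + 1), ∑ j ∈ Finset.Icc 1 r, β i j t * J i j x t := by
      have hL : ∫ u in Set.Ioi (0 : ℝ), F x u *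
          ∑ k ∈ Finset.Icc 1 m, α k t * mixedDeriv k 0 (evenPart p) t u =
          ∑ k ∈ Finset.Icc 1 m, α k t * J k 0 x t := by
        simp only [Finset.mul_sum]
        rw [integral_finsetSum _ fun k hk =>
          hint (Or.inl ⟨(Finset.mem_Icc.1 hk).2, rfl⟩) (α k t)]
        simp only [hpull]
      have hR : ∫ u in Set.Ioi (0 : ℝ), F x u * ∑ i ∈ Finset.range (q + 1),
          ∑ j ∈ Finset.Icc 1 r, β i j t * mixedDeriv i j (evenPart p) t u =
          ∑ i ∈ Finset.range (q + 1), ∑ j ∈ Finset.Icc 1 r, β i j t * J i j x t := by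
        simp only [Finset.mul_sum]
        have hij : ∀ i ∈ Finset.range (q + 1), ∀ j ∈ Finset.Icc 1 r, i ≤ q ∧ j ≤ r :=
          fun i hi j hj => ⟨Nat.lt_succ_iff.1 (Finset.mem_range.1 hi), (Finset.mem_Icc.1 hj).2⟩
        rw [integral_finsetSum _ fun i hi => integrable_finsetSum _ fun j hj =>
          hint (Or.inr (hij i hi j hj)) (β i j t)]
        refine Finset.sum_congr rfl fun i hi => ?_
        rw [integral_finsetSum _ fun j hj => hint (Or.inr (hij i hi j hj)) (β i j t)]
        simp only [hpull]
      rw [← hL, ← hR]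
      simp only [hY.equation t ht]
    have hbdry : ∀ i ≤ q, ∀ j ≤ r, ∑ k ∈ (Finset.range j).filter (fun k => 2 * k ≤ j - 1),
        (-1) ^ (j - 2 * k) * (generator P)^[j - 1 - 2 * k] g x * mixedDeriv i (2 * k) p t 0 =
          -((-1) ^ j * S i j x t) := by
      intro i hi j hj
      -- The middle factor is `∂_t^i ∂_u^l` of the even part at `u = 0`, written through the
      -- density: zero for odd `l`, the density's own derivative for even `l`.
      have hsum := sum_range_eq_sum_even (j := j) (a := fun l => (-1) ^ l *
        ((mixedDeriv i l p t 0 + (-1) ^ l * mixedDeriv i l p t 0) / 2) *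
          (generator P)^[j - 1 - l] g x) fun l hl => by simp [hl.neg_one_pow]
      have hSsum : S i j x t = -∑ l ∈ Finset.range j, (-1) ^ l *
          ((mixedDeriv i l p t 0 + (-1) ^ l * mixedDeriv i l p t 0) / 2) *
            (generator P)^[j - 1 - l] g x := by
        rw [hS, ← Finset.sum_neg_distrib]
        refine Finset.sum_congr rfl fun l hl => ?_
        rw [hY.mixedDeriv_evenPart hi ((Finset.mem_range.1 hl).le.trans hj) ht, neg_zero]
        ring
      rw [hSsum, ← hsum, mul_neg, neg_neg, Finset.mul_sum]
      refine Finset.sum_congr rfl fun k hk => ?_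
      have hk' : 2 * k ≤ j := (Finset.mem_filter.1 hk).2.trans (Nat.sub_le j 1)
      have hpow : (-1 : ℝ) ^ (j - 2 * k) = (-1) ^ j := by
        obtain ⟨l, rfl⟩ := Nat.exists_eq_add_of_le hk'
        rw [Nat.add_sub_cancel_left, pow_add, pow_mul]
        simp
      rw [hpow, pow_mul]
      simp only [even_two, Even.neg_pow, one_pow]
      ring
    have hlhs : ∑ k ∈ Finset.Icc 1 m, α k t * iteratedDeriv k (fun s => h s x) t =
        2 * ∑ k ∈ Finset.Icc 1 m, α k t * J k 0 x t := by
      rw [Finset.mul_sum]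
      refine Finset.sum_congr rfl fun k hk => ?_
      rw [hhk x k (Finset.mem_Icc.1 hk).2 t ht]
      ring
    rw [hlhs, heq, boundaryTerm, Finset.mul_sum, Finset.mul_sum, ← Finset.sum_add_distrib]
    refine Finset.sum_congr rfl fun i hi => ?_
    rw [Finset.mul_sum, Finset.mul_sum, ← Finset.sum_add_distrib]
    refine Finset.sum_congr rfl fun j hj => ?_
    have hi' : i ≤ q := Nat.lt_succ_iff.1 (Finset.mem_range.1 hi)
    have hj' : j ≤ r := (Finset.mem_Icc.1 hj).2
    rw [hgi x j hj' i hi' t ht, hbdry i hi' j hj']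
    have hsq : ((-1 : ℝ) ^ j) * (-1) ^ j = 1 := by rw [← mul_pow]; simp
    -- The boundary term cancels the contribution of `S`; what remains carries `(-1)^j` twice, once
    -- from the equation and once from the integrations by parts.
    linear_combination (-2 * β i j t * J i j x t) * hsq
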